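/- Fix $p\in[\tfrac12,1]$ and consider the following zero-sum repeated game. A system is in one of two states $\underline s,\bar s$; at each stage Player 1 plays $T$ or $B$ and Player 2 simultaneously plays $L$ or $R$. Player 1 wins $1$ if the state is $\underline s$ and the moves are $T,L$, or if the state is $\bar s$ and the moves are $B,R$; otherwise he wins $0$. After each stage the system stays in its state with probability $p$ and switches with probability $1-p$. Player 1 knows the current state and all past states and moves; Player 2 knows only the past moves. The initial state is $\underline s$ with probability $q$. A strategy gives, as a function of this information, the probability of playing $T$ (Player 1) or $L$ (Player 2). A strategy of Player 1 guarantees $v$ if against every strategy of Player 2 the lower limit of the expected average gain per stage is at least $v$; a strategy of Player 2 guarantees $v$ if against every strategy of Player 1 the upper limit is at most $v$. The number $v$ is the value if Player 1 can guarantee every $w<v$ and Player 2 every $w>v$. A strategy is optimal if the game has a value and the strategy guarantees it. Put $\gamma=2p-1$ and $$f_B(\theta)=\begin{cases}p\frac{2\theta-1}{\theta}+(1-p)\frac{1-\theta}{\theta}&\theta\ge\frac12\\ 1-p&\theta<\frac12\end{cases},\qquad f_T(\theta)=\begin{cases}p&\theta\ge\frac12\\ p\frac{\theta}{1-\theta}+(1-p)\frac{1-2\theta}{1-\theta}&\theta<\frac12\end{cases},$$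 and $\Phi(\theta)=f_B(\theta)$ if $\theta\ge\frac12$, $\Phi(\theta)=f_T(\theta)$ otherwise. An internal state $\theta$, started at $\theta_0$, is updated after each stage to $f_T(\theta)$ if Player 1 played $T$ and to $f_B(\theta)$ if he played $B$. The strategy $\sigma^*$ of Player 1 plays $T$ with probability $1$ (system in $\underline s$) or $\frac{1-2\theta}{1-\theta}$ (system in $\bar s$) if $\theta\le\frac12$, and with probability $\frac{1-\theta}{\theta}$ (system in $\underline s$) or $0$ (system in $\bar s$) if $\theta>\frac12$. The strategy $(x(\theta))_{\theta\in[1-p,p]}$ of Player 2 plays $L$ with probability $x(\theta)$, where $x$ is defined as follows. Let $$A(\theta)=\begin{pmatrix}p&1-p\\-\gamma&\gamma\end{pmatrix}\ (\theta>\tfrac12),\quad A(\theta)=\begin{pmatrix}\gamma&-\gamma\\1-p&p\end{pmatrix}\ (\theta<\tfrac12),\quad A(\tfrac12)=\tfrac12\begin{pmatrix}1-p&p\\1-p&p\end{pmatrix},$$ $$w(\theta)=\sum_{n\ge0}A(\theta)A(\Phi(\theta))\cdots A(\Phi^{n-1}(\theta))\begin{pmatrix}1\\1\end{pmatrix},\quad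 v=\frac1{p\,w_1(p)+(1-p)\,w_2(p)},\quad Z=\frac{(w_1(p)-w_2(p))v}{2},$$ $$\begin{pmatrix}G(\theta)\\H(\theta)\end{pmatrix}=(1-\gamma Z)\begin{pmatrix}1\\1\end{pmatrix}-v\,w(\theta),\qquad x(\theta)=\begin{cases}G(\theta)+v+\gamma Z&\theta>\frac12\\ \frac12&\theta=\frac12\\ 1-(H(\theta)+v+\gamma Z)&\theta<\frac12.\end{cases}$$ **Lemma.** If $\frac23\le p\le 0.719023$, then for every $q\in[0,1]$ and every $\theta_0\in[1-p,p]$, the strategy $\sigma^*$ started at $\theta_0$ is an optimal strategy of Player 1 and the strategy $(x(\theta))_{\theta\in[1-p,p]}$ started at $\theta_0$ is an optimal strategy of Player 2. -/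

import Mathlib

open Filter Set

namespace AsymGame

/-! ## The repeated game -/

/-- The two states of the system: `lo` is `s̲` and `hi` is `s̄`. -/
inductive Sys | lo | hi

/-- The actions of Player 1 (top, bottom). -/
inductive Act1 | T | B

/-- The actions of Player 2 (left, right). -/
inductive Act2 | L | R

/-- The other state. -/
def Sys.flip : Sys → Sys
  | .lo => .hi
  | .hi => .lo

/-- The winnings of Player 1 in one stage. -/
def stageGain : Sys → Act1 → Act2 → ℝ
  | .lo, .T, .L => 1
  | .hi, .B, .R => 1
  | _, _, _ => 0

/-- A strategy of Player 1: the probability of playing `T`, given the past states and moves of both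
players (most recent stage first) and the current state. -/
abbrev Strategy1 := List (Sys × Act1 × Act2) → Sys → ℝ

/-- A strategy of Player 2: the probability of playing `L`, given the past moves of both players
(most recent stage first). -/
abbrev Strategy2 := List (Act1 × Act2) → ℝ

/-- The values of a strategy of Player 1 are probabilities. -/
def IsStrategy1 (σ : Strategy1) : Prop := ∀ h s, σ h s ∈ Icc (0 : ℝ) 1

/-- The values of a strategy of Player 2 are probabilities. -/
def IsStrategy2 (τ : Strategy2) : Prop := ∀ h, τ h ∈ Icc (0 : ℝ) 1

/-- Expectation of a two-valued random variable: `a` with probability `w`, otherwise `b`. -/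
def mix (w a b : ℝ) : ℝ := w * a + (1 - w) * b

/-- `expGain p σ τ n h s` is the expected total gain of Player 1 over the next `n` stages, if the
past is `h`, the current state is `s`, the players draw their moves independently according to
`σ` and `τ`, and after every stage the system stays in its state with probability `p` and switches
with probability `1 - p`. -/
noncomputable def expGain (p : ℝ) (σ : Strategy1) (τ : Strategy2) :
    ℕ → List (Sys × Act1 × Act2) → Sys → ℝ
  | 0, _, _ => 0
  | n + 1, h, s =>
    let y := τ (h.map Prod.snd)
    let next : Act1 → Act2 → ℝ := fun a b =>
      stageGain s a b +
        mix p (expGain p σ τ n ((s, a, b) :: h) s) (expGain p σ τ n ((s, a, b) :: h) s.flip)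
    mix (σ h s) (mix y (next .T .L) (next .T .R)) (mix y (next .B .L) (next .B .R))

/-- The expected average gain per stage over the first `n` stages, if the initial state is `s̲`
with probability `q`. -/
noncomputable def avgGain (p q : ℝ) (σ : Strategy1) (τ : Strategy2) (n : ℕ) : ℝ :=
  mix q (expGain p σ τ n [] .lo) (expGain p σ τ n [] .hi) / n

/-- Against every strategy of Player 2, the lower limit of the expected average gain under `σ` is at
least `v`. -/
def Guarantees1 (p q : ℝ) (σ : Strategy1) (v : ℝ) : Prop :=
  ∀ τ, IsStrategy2 τ → ∀ ε > 0, ∀ᶠ n in atTop, v - ε ≤ avgGain p q σ τ n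

/-- Against every strategy of Player 1, the upper limit of the expected average gain under `τ` is at
most `v`. -/
def Guarantees2 (p q : ℝ) (τ : Strategy2) (v : ℝ) : Prop :=
  ∀ σ, IsStrategy1 σ → ∀ ε > 0, ∀ᶠ n in atTop, avgGain p q σ τ n ≤ v + ε

/-- `v` is the value of the game: Player 1 can guarantee every smaller number and Player 2 can
guarantee every larger one. -/
def IsValue (p q v : ℝ) : Prop :=
  (∀ w < v, ∃ σ, IsStrategy1 σ ∧ Guarantees1 p q σ w) ∧
    (∀ w > v, ∃ τ, IsStrategy2 τ ∧ Guarantees2 p q τ w)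

/-- `σ` is an optimal strategy of Player 1: it guarantees the value of the game. -/
def IsOptimal1 (p q : ℝ) (σ : Strategy1) : Prop :=
  IsStrategy1 σ ∧ ∃ v, IsValue p q v ∧ Guarantees1 p q σ v

/-- `τ` is an optimal strategy of Player 2: it guarantees the value of the game. -/
def IsOptimal2 (p q : ℝ) (τ : Strategy2) : Prop :=
  IsStrategy2 τ ∧ ∃ v, IsValue p q v ∧ Guarantees2 p q τ v

/-! ## The belief automaton and the strategy `σ*` -/

/-- The new internal state after Player 1 plays `B`. -/
noncomputable def fB (p θ : ℝ) : ℝ :=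
  if 1 / 2 ≤ θ then p * ((2 * θ - 1) / θ) + (1 - p) * ((1 - θ) / θ) else 1 - p

/-- The new internal state after Player 1 plays `T`. -/
noncomputable def fT (p θ : ℝ) : ℝ :=
  if 1 / 2 ≤ θ then p else p * (θ / (1 - θ)) + (1 - p) * ((1 - 2 * θ) / (1 - θ))

/-- The map `Φ`. -/
noncomputable def Phi (p θ : ℝ) : ℝ := if 1 / 2 ≤ θ then fB p θ else fT p θ

/-- The internal state after the given moves of Player 1 (most recent first), starting from `θ₀`. -/
noncomputable def belief (p θ₀ : ℝ) : List Act1 → ℝ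
  | [] => θ₀
  | .T :: l => fT p (belief p θ₀ l)
  | .B :: l => fB p (belief p θ₀ l)

/-- The probability with which `σ*` plays `T` in the internal state `θ`; the two cases of the
definition agree at `θ = 1/2`. -/
noncomputable def sigmaT (θ : ℝ) : Sys → ℝ
  | .lo => if θ ≤ 1 / 2 then 1 else (1 - θ) / θ
  | .hi => if θ ≤ 1 / 2 then (1 - 2 * θ) / (1 - θ) else 0

/-- The strategy `σ*` of Player 1, started in the internal state `θ₀`. -/
noncomputable def sigmaStar (p θ₀ : ℝ) : Strategy1 := fun h s =>
  sigmaT (belief p θ₀ (h.map fun e => e.2.1)) s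

/-- The strategy of Player 2 that runs the same automaton, started in the state `θ₀`, and plays `L`
with probability `x θ` in the state `θ`. -/
noncomputable def automatonStrategy (p θ₀ : ℝ) (x : ℝ → ℝ) : Strategy2 := fun h =>
  x (belief p θ₀ (h.map Prod.fst))

/-! ## The function `x(θ)` -/

/-- The constant `γ = 2p - 1`. -/
def gam (p : ℝ) : ℝ := 2 * p - 1

/-- The matrix `A₁` for `θ > 1/2` and `A₀` for `θ < 1/2`. For `θ = 1/2` it is
`(A₁ + A₀ J) / 2`, where `J` exchanges the coordinates: as `Φ(1/2) = 1 - p`, this choice encodes the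
equation `G(1/2) = H(1/2) = 1/2 - v - γ Z` (see `score_half`). -/
noncomputable def sideMat (p θ : ℝ) : Matrix (Fin 2) (Fin 2) ℝ :=
  if 1 / 2 < θ then !![p, 1 - p; -gam p, gam p]
  else if θ < 1 / 2 then !![gam p, -gam p; 1 - p, p]
  else !![(1 - p) / 2, p / 2; (1 - p) / 2, p / 2]

/-- The product of the first `n` side matrices along the `Φ`-orbit of `θ`. -/
noncomputable def sideProd (p : ℝ) : ℕ → ℝ → Matrix (Fin 2) (Fin 2) ℝ
  | 0, _ => 1
  | n + 1, θ => sideMat p θ * sideProd p n (Phi p θ)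

/-- The vector `(I + A_{η₀} + A_{η₀} A_{η₁} + ⋯) (1, 1)ᵀ` for the orbit of `θ`. -/
noncomputable def wVec (p θ : ℝ) : Fin 2 → ℝ :=
  ∑' n, (sideProd p n θ).mulVec (fun _ => 1)

/-- The number `v`. -/
noncomputable def vStar (p : ℝ) : ℝ := 1 / (p * wVec p p 0 + (1 - p) * wVec p p 1)

/-- The number `Z`. -/
noncomputable def ZStar (p : ℝ) : ℝ := (wVec p p 0 - wVec p p 1) * vStar p / 2

/-- The relative score `G(θ)` of the position `(s̲, θ)`. -/
noncomputable def scoreG (p θ : ℝ) : ℝ := 1 - gam p * ZStar p - vStar p * wVec p θ 0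

/-- The relative score `H(θ)` of the position `(s̄, θ)`. -/
noncomputable def scoreH (p θ : ℝ) : ℝ := 1 - gam p * ZStar p - vStar p * wVec p θ 1

/-- The probability `x(θ)` that Player 2 plays `L` in the state `θ`. -/
noncomputable def xStar (p θ : ℝ) : ℝ :=
  if 1 / 2 < θ then scoreG p θ + vStar p + gam p * ZStar p
  else if θ < 1 / 2 then 1 - (scoreH p θ + vStar p + gam p * ZStar p)
  else 1 / 2

/-! ## The defining equations of the scores

The series converge, and the scores satisfy the equations they are meant to solve. -/

theorem sideMat_contr {p : ℝ} (hp : p ∈ Icc (1 / 2 : ℝ) (3 / 4)) (θ : ℝ) (u : Fin 2 → ℝ) :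
    ((sideMat p θ).mulVec u 0) ^ 2 + ((sideMat p θ).mulVec u 1) ^ 2
      ≤ (19 / 20) ^ 2 * (u 0 ^ 2 + u 1 ^ 2) := by
  obtain ⟨h1, h2⟩ := hp
  obtain ⟨g, hg⟩ : ∃ g, g = 2 * p - 1 := ⟨_, rfl⟩
  have hp' : p = (1 + g) / 2 := by linarith
  have g0 : 0 ≤ g := by linarith
  have g1 : g ≤ 1 / 2 := by linarith
  have g2 : g ^ 2 ≤ 1 / 4 := by nlinarith
  unfold sideMat gam
  split_ifs <;>
    simp only [Matrix.mulVec, dotProduct, Fin.sum_univ_two, Matrix.of_apply, Matrix.cons_val',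
      Matrix.cons_val_zero, Matrix.cons_val_one, Matrix.cons_val_fin_one] <;>
    subst hp' <;>
    generalize u 0 = a <;> generalize u 1 = b
  · have h3 : g * (a + b) * (b - a) ≤ (1 / 4) * ((a + b) ^ 2 + (b - a) ^ 2) := by
      nlinarith [mul_nonneg g0 (sq_nonneg (a + b - (b - a))),
        mul_nonneg (sub_nonneg.2 g1) (add_nonneg (sq_nonneg (a + b)) (sq_nonneg (b - a)))]
    have h4 : g ^ 2 * (b - a) ^ 2 ≤ 1 / 4 * (b - a) ^ 2 :=
      mul_le_mul_of_nonneg_right g2 (sq_nonneg _)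
    nlinarith [sq_nonneg (a + b), sq_nonneg (b - a)]
  · have h3 : g * (a + b) * (b - a) ≤ (1 / 4) * ((a + b) ^ 2 + (b - a) ^ 2) := by
      nlinarith [mul_nonneg g0 (sq_nonneg (a + b - (b - a))),
        mul_nonneg (sub_nonneg.2 g1) (add_nonneg (sq_nonneg (a + b)) (sq_nonneg (b - a)))]
    have h4 : g ^ 2 * (b - a) ^ 2 ≤ 1 / 4 * (b - a) ^ 2 :=
      mul_le_mul_of_nonneg_right g2 (sq_nonneg _)
    nlinarith [sq_nonneg (a + b), sq_nonneg (b - a)]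
  · have h3 : g * (a + b) * (b - a) ≤ (1 / 4) * ((a + b) ^ 2 + (b - a) ^ 2) := by
      nlinarith [mul_nonneg g0 (sq_nonneg (a + b - (b - a))),
        mul_nonneg (sub_nonneg.2 g1) (add_nonneg (sq_nonneg (a + b)) (sq_nonneg (b - a)))]
    have h4 : g ^ 2 * (b - a) ^ 2 ≤ 1 / 4 * (b - a) ^ 2 :=
      mul_le_mul_of_nonneg_right g2 (sq_nonneg _)
    nlinarith [sq_nonneg (a + b), sq_nonneg (b - a)]

theorem sideProd_bound {p : ℝ} (hp : p ∈ Icc (1 / 2 : ℝ) (3 / 4)) (n : ℕ) : ∀ θ : ℝ,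
    ((sideProd p n θ).mulVec (fun _ => 1) 0) ^ 2 + ((sideProd p n θ).mulVec (fun _ => 1) 1) ^ 2
      ≤ ((19 / 20) ^ n) ^ 2 * 2 := by
  induction n with
  | zero => intro θ; norm_num [sideProd]
  | succ n ih =>
    intro θ
    rw [sideProd, ← Matrix.mulVec_mulVec]
    refine (sideMat_contr hp θ _).trans ?_
    calc _ ≤ (19 / 20 : ℝ) ^ 2 * (((19 / 20) ^ n) ^ 2 * 2) :=
          mul_le_mul_of_nonneg_left (ih _) (by norm_num)
      _ = _ := by ring

/-- The series that defines `wVec` converges. -/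
theorem summable_wVec {p : ℝ} (hp : p ∈ Icc (1 / 2 : ℝ) (3 / 4)) (θ : ℝ) :
    Summable fun n => (sideProd p n θ).mulVec (fun _ => (1 : ℝ)) := by
  rw [Pi.summable]
  intro i
  refine Summable.of_norm_bounded (g := fun n => (19 / 20 : ℝ) ^ n * 2)
    ((summable_geometric_of_lt_one (by norm_num) (by norm_num)).mul_right 2) fun n => ?_
  have h := sideProd_bound hp n θ
  have h0 : (0 : ℝ) ≤ (19 / 20 : ℝ) ^ n := by positivity
  rw [Real.norm_eq_abs]
  refine abs_le_of_sq_le_sq ?_ (by positivity)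
  fin_cases i <;> simp only [Fin.zero_eta, Fin.mk_one] <;>
    nlinarith [sq_nonneg ((sideProd p n θ).mulVec (fun _ => (1 : ℝ)) 0),
      sq_nonneg ((sideProd p n θ).mulVec (fun _ => (1 : ℝ)) 1), sq_nonneg ((19 / 20 : ℝ) ^ n)]

theorem wVec_step {p : ℝ} (hp : p ∈ Icc (1 / 2 : ℝ) (3 / 4)) (θ : ℝ) :
    wVec p θ = (fun _ => 1) + (sideMat p θ).mulVec (wVec p (Phi p θ)) := by
  rw [wVec, (summable_wVec hp θ).tsum_eq_zero_add]
  congr 1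
  · simp [sideProd]
  · have h := (summable_wVec hp (Phi p θ)).map_tsum
      (LinearMap.toContinuousLinearMap (Matrix.mulVecLin (sideMat p θ)))
      (LinearMap.toContinuousLinearMap (Matrix.mulVecLin (sideMat p θ))).continuous
    simp only [LinearMap.coe_toContinuousLinearMap', Matrix.mulVecLin_apply] at h
    rw [wVec, h]
    simp only [sideProd, Matrix.mulVec_mulVec]

theorem sideProd_symm (p : ℝ) (n : ℕ) : ∀ θ : ℝ,
    (sideProd p n (1 - θ)).mulVec (fun _ => 1) 0 = (sideProd p n θ).mulVec (fun _ => 1) 1 ∧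
    (sideProd p n (1 - θ)).mulVec (fun _ => 1) 1 = (sideProd p n θ).mulVec (fun _ => 1) 0 := by
  induction n with
  | zero => intro θ; simp [sideProd]
  | succ n ih =>
    intro θ
    rcases lt_trichotomy θ (1 / 2) with h | h | h
    · have hΦ : Phi p (1 - θ) = 1 - Phi p θ := by
        have h1 : (1 : ℝ) - θ ≠ 0 := by linarith
        simp only [Phi, fB, fT, if_pos (show (1 / 2 : ℝ) ≤ 1 - θ by linarith), if_neg (not_le.2 h)]
        field_simp
        ring
      obtain ⟨i0, i1⟩ := ih (Phi p θ)
      simp only [sideProd, ← Matrix.mulVec_mulVec, hΦ]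
      generalize (sideProd p n (1 - Phi p θ)).mulVec (fun _ => 1) = a at *
      generalize (sideProd p n (Phi p θ)).mulVec (fun _ => 1) = b at *
      simp only [sideMat, if_pos (show (1 / 2 : ℝ) < 1 - θ by linarith), if_pos h,
        if_neg (not_lt.2 h.le)]
      simp [Matrix.mulVec, dotProduct, Fin.sum_univ_two, i0, i1]
      constructor <;> ring
    · subst h
      simp only [sideProd, ← Matrix.mulVec_mulVec, show (1 : ℝ) - 1 / 2 = 1 / 2 by norm_num]
      simp [sideMat, Matrix.mulVec, dotProduct, Fin.sum_univ_two]
    · have hΦ : Phi p (1 - θ) = 1 - Phi p θ := by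
        have h1 : θ ≠ 0 := by linarith
        simp only [Phi, fB, fT, if_neg (show ¬ (1 / 2 : ℝ) ≤ 1 - θ by linarith), if_pos h.le,
          sub_sub_cancel]
        field_simp
        ring
      obtain ⟨i0, i1⟩ := ih (Phi p θ)
      simp only [sideProd, ← Matrix.mulVec_mulVec, hΦ]
      generalize (sideProd p n (1 - Phi p θ)).mulVec (fun _ => 1) = a at *
      generalize (sideProd p n (Phi p θ)).mulVec (fun _ => 1) = b at *
      simp only [sideMat, if_neg (show ¬ (1 / 2 : ℝ) < 1 - θ by linarith), if_pos h,
        if_pos (show 1 - θ < (1 / 2 : ℝ) by linarith)]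
      simp [Matrix.mulVec, dotProduct, Fin.sum_univ_two, i0, i1]
      constructor <;> ring

theorem wVec_apply {p : ℝ} (hp : p ∈ Icc (1 / 2 : ℝ) (3 / 4)) (θ : ℝ) (i : Fin 2) :
    wVec p θ i = ∑' n, (sideProd p n θ).mulVec (fun _ => 1) i := by
  rw [wVec, tsum_apply (summable_wVec hp θ)]

/-- The symmetry `G(1 - θ) = H(θ)`. -/
theorem score_symm {p : ℝ} (hp : p ∈ Icc (1 / 2 : ℝ) (3 / 4)) (θ : ℝ) :
    scoreG p (1 - θ) = scoreH p θ := by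
  simp only [scoreG, scoreH, wVec_apply hp, (sideProd_symm p _ θ).1]

/-- The equation for the scores at `θ > 1/2`. -/
theorem score_gt {p : ℝ} (hp : p ∈ Icc (1 / 2 : ℝ) (3 / 4)) {θ : ℝ} (h : 1 / 2 < θ) :
    scoreG p θ = p * scoreG p (Phi p θ) + (1 - p) * scoreH p (Phi p θ) - vStar p ∧
    scoreH p θ = -gam p * scoreG p (Phi p θ) + gam p * scoreH p (Phi p θ) - vStar p
      + (1 - gam p * ZStar p) := by
  simp only [scoreG, scoreH, wVec_step hp θ, sideMat, if_pos h]
  simp only [Matrix.mulVec, dotProduct, Fin.sum_univ_two, Matrix.of_apply, Matrix.cons_val',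
    Matrix.cons_val_zero, Matrix.cons_val_one, Matrix.cons_val_fin_one, Pi.add_apply]
  constructor <;> ring

/-- The equation for the scores at `θ < 1/2`. -/
theorem score_lt {p : ℝ} (hp : p ∈ Icc (1 / 2 : ℝ) (3 / 4)) {θ : ℝ} (h : θ < 1 / 2) :
    scoreG p θ = gam p * scoreG p (Phi p θ) - gam p * scoreH p (Phi p θ) - vStar p
      + (1 - gam p * ZStar p) ∧
    scoreH p θ = (1 - p) * scoreG p (Phi p θ) + p * scoreH p (Phi p θ) - vStar p := by
  simp only [scoreG, scoreH, wVec_step hp θ, sideMat, if_pos h, if_neg (not_lt.2 h.le)]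
  simp only [Matrix.mulVec, dotProduct, Fin.sum_univ_two, Matrix.of_apply, Matrix.cons_val',
    Matrix.cons_val_zero, Matrix.cons_val_one, Matrix.cons_val_fin_one, Pi.add_apply]
  constructor <;> ring

theorem sideProd_nonneg (p : ℝ) (n : ℕ) : ∀ θ : ℝ,
    0 ≤ θ * (sideProd p n θ).mulVec (fun _ => 1) 0
      + (1 - θ) * (sideProd p n θ).mulVec (fun _ => 1) 1 := by
  induction n with
  | zero => intro θ; simp [sideProd]
  | succ n ih =>
    intro θ
    have key := ih (Phi p θ)
    simp only [sideProd, ← Matrix.mulVec_mulVec]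
    generalize (sideProd p n (Phi p θ)).mulVec (fun _ => 1) = a at *
    rcases lt_trichotomy θ (1 / 2) with h | h | h
    · have h1 : (0 : ℝ) < 1 - θ := by linarith
      have hΦ : (1 - θ) * Phi p θ = p * θ + (1 - p) * (1 - 2 * θ) := by
        simp only [Phi, fT, if_neg (not_le.2 h)]
        field_simp
      simp only [sideMat, if_pos h, if_neg (not_lt.2 h.le)]
      simp [Matrix.mulVec, dotProduct, Fin.sum_univ_two, gam]
      have := mul_nonneg h1.le key
      linear_combination this + (a 0 - a 1) * hΦ
    · subst h
      have hΦ : Phi p (1 / 2) = 1 - p := by norm_num [Phi, fB]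
      rw [hΦ] at key
      simp only [sideMat, lt_irrefl, if_false]
      simp [Matrix.mulVec, dotProduct, Fin.sum_univ_two]
      linarith
    · have h1 : (0 : ℝ) < θ := by linarith
      have hΦ : θ * Phi p θ = p * (2 * θ - 1) + (1 - p) * (1 - θ) := by
        simp only [Phi, fB, if_pos h.le]
        field_simp
      simp only [sideMat, if_pos h]
      simp [Matrix.mulVec, dotProduct, Fin.sum_univ_two, gam]
      have := mul_nonneg h1.le key
      linear_combination this + (a 0 - a 1) * hΦ

/-- The denominator of `v` is positive. -/
theorem one_le_denom {p : ℝ} (hp : p ∈ Icc (1 / 2 : ℝ) (3 / 4)) :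
    1 ≤ p * wVec p p 0 + (1 - p) * wVec p p 1 := by
  have hs := Pi.summable.1 (summable_wVec hp p)
  have hsum : Summable fun n => p * (sideProd p n p).mulVec (fun _ => 1) 0
      + (1 - p) * (sideProd p n p).mulVec (fun _ => 1) 1 :=
    ((hs 0).mul_left p).add ((hs 1).mul_left (1 - p))
  have h := hsum.le_tsum 0 fun n _ => sideProd_nonneg p n p
  rw [((hs 0).mul_left p).tsum_add ((hs 1).mul_left (1 - p)), tsum_mul_left, tsum_mul_left,
    ← wVec_apply hp, ← wVec_apply hp] at h
  simpa [sideProd] using h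

/-- The normalization `G(p) = -Z`, `H(p) = Z`. -/
theorem score_base {p : ℝ} (hp : p ∈ Icc (1 / 2 : ℝ) (3 / 4)) :
    scoreG p p = -ZStar p ∧ scoreH p p = ZStar p := by
  have h0 : p * wVec p p 0 + (1 - p) * wVec p p 1 ≠ 0 := by linarith [one_le_denom hp]
  have hv : vStar p * (p * wVec p p 0 + (1 - p) * wVec p p 1) = 1 := by
    rw [vStar, one_div, inv_mul_cancel₀ h0]
  simp only [scoreG, scoreH, ZStar, gam]
  constructor <;> linear_combination -hv

/-- The equation for the scores at `θ = 1/2`. -/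
theorem score_half {p : ℝ} (hp : p ∈ Icc (1 / 2 : ℝ) (3 / 4)) :
    scoreG p (1 / 2) = 1 / 2 - vStar p - gam p * ZStar p ∧
    scoreH p (1 / 2) = 1 / 2 - vStar p - gam p * ZStar p := by
  obtain ⟨b0, b1⟩ := score_base hp
  have hΦ : Phi p (1 / 2) = 1 - p := by norm_num [Phi, fB]
  have e0 : wVec p (1 - p) 0 = wVec p p 1 := by
    simp only [wVec_apply hp, (sideProd_symm p _ p).1]
  have e1 : wVec p (1 - p) 1 = wVec p p 0 := by
    simp only [wVec_apply hp, (sideProd_symm p _ p).2]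
  simp only [scoreG, scoreH] at *
  simp only [wVec_step hp (1 / 2), hΦ, sideMat, lt_irrefl, if_false, Matrix.mulVec, dotProduct,
    Fin.sum_univ_two, Matrix.of_apply, Matrix.cons_val', Matrix.cons_val_zero, Matrix.cons_val_one,
    Matrix.cons_val_fin_one, Pi.add_apply, e0, e1]
  unfold gam at *
  constructor <;> linear_combination ((1 - p) / 2) * b1 + (p / 2) * b0

end AsymGame

/-! ### Invariance of the interval `[1 - p, p]`. -/

namespace AsymGame

/-! Both players guarantee `vStar p`, hence it is the value and both strategies are optimal.

Player 1: suppose the internal state `θ` is the true belief in `lo`. Whatever Player 2 does, one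
stage of `σ*` pays `min θ (1 - θ)`, which is also the probability of a revealing action (`T` for `θ
> 1/2`, `B` for `θ ≤ 1/2`), after which the belief is `p` or `1 - p`. The mean `wMean p θ` is the
expected number of stages up to and including the next revelation, so renewal gives the rate `1 /
wMean p p`, with `vStar p * wMean p θ` as the bounded error (`le_expGain_sigmaStar_belief`). An
arbitrary `θ₀` costs only a bounded loss, since the first revelation makes the internal state
correct (`le_expGain_sigmaStar`).

Player 2: the scores form a bounded potential. If for each state and action the expected gain plus
the expected next score is at most the present score plus `v`, the total gain is at most `n v` plus
a constant (`expGain_le_of_potential`). For `θ > 1/2` three of the four inequalities are equalities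
by construction; there remain the action `T` in state `hi` and `x θ ∈ [0, 1]`. In the mean `m` and
the difference `d` of the coordinates of `w`, these become the inequalities of `succ_bounds`.

For these, `m` is even and `d` odd about `1/2`, so the orbit folds onto `[1/2, p]`; the folded map
has a low branch on `[1/2, 2/3)` and a high branch on `[2/3, p]` (`FoldedSystem`). Two-step
recursions give `mLow ≤ m ≤ mUp`. The number `dUp` is chosen so that `d ≤ dUp` yields `2 γ d(p) ≤ 1
+ p * mLow ≤ m(p)`. The key fact `0 ≤ d ≤ dUp` (`diff_mem`) follows because one application of the
recursion shrinks any violation of it by the factor `9/10` (`diff_step`). -/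

theorem fB_mem {p θ : ℝ} (hp : p ∈ Icc (1 / 2 : ℝ) (3 / 4)) (hθ : θ ∈ Icc (1 - p) p) :
    fB p θ ∈ Icc (1 - p) p := by
  obtain ⟨h1, h2⟩ := hp
  obtain ⟨h3, h4⟩ := hθ
  have h0 : 0 < θ := by linarith
  unfold fB
  split_ifs with h
  · have e : p * ((2 * θ - 1) / θ) + (1 - p) * ((1 - θ) / θ)
        = (p * (2 * θ - 1) + (1 - p) * (1 - θ)) / θ := by field_simp
    rw [e, mem_Icc, le_div_iff₀ h0, div_le_iff₀ h0]
    constructor <;> nlinarith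
  · constructor <;> linarith

/-- The symmetry that exchanges the two states and the actions `T`, `B`; it reduces `θ < 1/2` to `θ
> 1/2`. -/
theorem fT_eq_one_sub_fB {p θ : ℝ} (h : θ < 1 / 2) : fT p θ = 1 - fB p (1 - θ) := by
  have h1 : (1 : ℝ) - θ ≠ 0 := by linarith
  rw [fB, fT, if_neg (not_le.2 h), if_pos (by linarith)]
  field_simp
  ring

theorem fT_mem {p θ : ℝ} (hp : p ∈ Icc (1 / 2 : ℝ) (3 / 4)) (hθ : θ ∈ Icc (1 - p) p) :
    fT p θ ∈ Icc (1 - p) p := by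
  rcases lt_or_ge θ (1 / 2) with h | h
  · have := fB_mem hp (θ := 1 - θ) ⟨by linarith [hθ.2], by linarith [hθ.1]⟩
    rw [fT_eq_one_sub_fB h]
    exact ⟨by linarith [this.2], by linarith [this.1]⟩
  · rw [fT, if_pos h]
    exact ⟨by linarith [hp.1], le_rfl⟩

theorem belief_mem {p θ₀ : ℝ} (hp : p ∈ Icc (1 / 2 : ℝ) (3 / 4)) (hθ : θ₀ ∈ Icc (1 - p) p) :
    ∀ l, belief p θ₀ l ∈ Icc (1 - p) p
  | [] => hθ
  | .T :: l => fT_mem hp (belief_mem hp hθ l)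
  | .B :: l => fB_mem hp (belief_mem hp hθ l)

/-! ### Potentials, guarantees and optimality -/

theorem mix_le_mix {w a b a' b' : ℝ} (hw : w ∈ Icc (0 : ℝ) 1) (ha : a ≤ a') (hb : b ≤ b') :
    mix w a b ≤ mix w a' b' :=
  add_le_add (mul_le_mul_of_nonneg_left ha hw.1)
    (mul_le_mul_of_nonneg_left hb (sub_nonneg.2 hw.2))

theorem mix_self (w a : ℝ) : mix w a a = a := by unfold mix; ring

theorem mix_add_const (w a b c : ℝ) : mix w (a + c) (b + c) = mix w a b + c := by unfold mix; ring

/-- A bounded potential `V` on (state, internal state) that dominates every action of Player 1 bounds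
the gain against an automaton strategy of Player 2. -/
theorem expGain_le_of_potential {p θ₀ v C : ℝ} {x : ℝ → ℝ} {V : Sys → ℝ → ℝ}
    (hp : p ∈ Icc (1 / 2 : ℝ) (3 / 4)) (hθ₀ : θ₀ ∈ Icc (1 - p) p)
    (hx : ∀ θ ∈ Icc (1 - p) p, x θ ∈ Icc (0 : ℝ) 1)
    (hT : ∀ θ ∈ Icc (1 - p) p, ∀ s, mix (x θ) (stageGain s .T .L) (stageGain s .T .R)
      + mix p (V s (fT p θ)) (V s.flip (fT p θ)) ≤ V s θ + v)
    (hB : ∀ θ ∈ Icc (1 - p) p, ∀ s, mix (x θ) (stageGain s .B .L) (stageGain s .B .R)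
      + mix p (V s (fB p θ)) (V s.flip (fB p θ)) ≤ V s θ + v)
    (hC : ∀ θ ∈ Icc (1 - p) p, ∀ s, -C ≤ V s θ)
    {σ : Strategy1} (hσ : IsStrategy1 σ) (n : ℕ) : ∀ h s,
    expGain p σ (automatonStrategy p θ₀ x) n h s
      ≤ n * v + V s (belief p θ₀ (h.map fun e => e.2.1)) + C := by
  induction n with
  | zero =>
    intro h s
    have := hC _ (belief_mem hp hθ₀ (h.map fun e => e.2.1)) s
    simp only [expGain, Nat.cast_zero]
    linarith
  | succ n ih =>
    intro h s
    have hb := belief_mem hp hθ₀ (h.map fun e => e.2.1)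
    have e : automatonStrategy p θ₀ x (h.map Prod.snd)
        = x (belief p θ₀ (h.map fun e => e.2.1)) := by
      simp [automatonStrategy, Function.comp_def]
    have hp01 : p ∈ Icc (0 : ℝ) 1 := ⟨by linarith [hp.1], by linarith [hp.2]⟩
    have key : ∀ a b, mix p (expGain p σ (automatonStrategy p θ₀ x) n ((s, a, b) :: h) s)
        (expGain p σ (automatonStrategy p θ₀ x) n ((s, a, b) :: h) s.flip)
        ≤ mix p (V s (belief p θ₀ (a :: h.map fun e => e.2.1)))
          (V s.flip (belief p θ₀ (a :: h.map fun e => e.2.1))) + (n * v + C) := by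
      intro a b
      rw [← mix_add_const]
      exact mix_le_mix hp01 ((ih _ _).trans_eq (by simp only [List.map_cons]; ring))
        ((ih _ _).trans_eq (by simp only [List.map_cons]; ring))
    simp only [expGain, e]
    rw [← mix_self (σ h s) (((n + 1 : ℕ) : ℝ) * v + _ + C)]
    refine mix_le_mix (hσ h s) ?_ ?_
    · refine (mix_le_mix (hx _ hb) (add_le_add le_rfl (key .T .L))
        (add_le_add le_rfl (key .T .R))).trans ?_
      rw [mix_add_const]
      have := hT _ hb s
      simp only [belief]
      push_cast
      linarith
    · refine (mix_le_mix (hx _ hb) (add_le_add le_rfl (key .B .L))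
        (add_le_add le_rfl (key .B .R))).trans ?_
      rw [mix_add_const]
      have := hB _ hb s
      simp only [belief]
      push_cast
      linarith

theorem eventually_div_le (C : ℝ) {ε : ℝ} (hε : 0 < ε) : ∀ᶠ n : ℕ in atTop, 0 < n ∧ C / n ≤ ε :=
  (eventually_gt_atTop 0).and
    ((tendsto_const_div_atTop_nhds_zero_nat C).eventually (eventually_le_nhds hε))

theorem guarantees2_of_bound {p q v C : ℝ} {τ : Strategy2} (hq : q ∈ Icc (0 : ℝ) 1)
    (h : ∀ σ, IsStrategy1 σ → ∀ n s, expGain p σ τ n [] s ≤ n * v + C) :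
    Guarantees2 p q τ v := by
  intro σ hσ ε hε
  filter_upwards [eventually_div_le C hε] with n hn
  have hn0 : (0 : ℝ) < n := by exact_mod_cast hn.1
  have h1 : mix q (expGain p σ τ n [] .lo) (expGain p σ τ n [] .hi) ≤ n * v + C := by
    rw [← mix_self q (n * v + C)]
    exact mix_le_mix hq (h σ hσ n _) (h σ hσ n _)
  rw [avgGain]
  calc _ ≤ (n * v + C) / n := by gcongr
    _ = v + C / n := by field_simp
    _ ≤ v + ε := by linarith [hn.2]

theorem guarantees1_of_bound {p q v C : ℝ} {σ : Strategy1} (hq : q ∈ Icc (0 : ℝ) 1)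
    (h : ∀ τ, IsStrategy2 τ → ∀ n s, n * v - C ≤ expGain p σ τ n [] s) :
    Guarantees1 p q σ v := by
  intro τ hτ ε hε
  filter_upwards [eventually_div_le C hε] with n hn
  have hn0 : (0 : ℝ) < n := by exact_mod_cast hn.1
  have h1 : n * v - C ≤ mix q (expGain p σ τ n [] .lo) (expGain p σ τ n [] .hi) := by
    rw [← mix_self q (n * v - C)]
    exact mix_le_mix hq (h τ hτ n _) (h τ hτ n _)
  rw [avgGain]
  calc v - ε ≤ v - C / n := by linarith [hn.2]
    _ = (n * v - C) / n := by field_simp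
    _ ≤ _ := by gcongr

theorem optimal_of_guarantees {p q v : ℝ} {σ : Strategy1} {τ : Strategy2} (hσ : IsStrategy1 σ)
    (hτ : IsStrategy2 τ) (h1 : Guarantees1 p q σ v) (h2 : Guarantees2 p q τ v) :
    IsOptimal1 p q σ ∧ IsOptimal2 p q τ := by
  have hv : IsValue p q v := by
    refine ⟨fun w hw => ⟨σ, hσ, fun τ' hτ' ε hε => ?_⟩, fun w hw => ⟨τ, hτ, fun σ' hσ' ε hε => ?_⟩⟩
    · filter_upwards [h1 τ' hτ' ε hε] with n hn
      linarith
    · filter_upwards [h2 σ' hσ' ε hε] with n hn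
      linarith
  exact ⟨⟨hσ, v, hv, h1⟩, hτ, v, hv, h2⟩

/-! ### Basic properties of `σ*` -/

theorem sigmaT_mem {p θ : ℝ} (hp : p ∈ Icc (1 / 2 : ℝ) (3 / 4)) (hθ : θ ∈ Icc (1 - p) p) (s : Sys) :
    sigmaT θ s ∈ Icc (0 : ℝ) 1 := by
  obtain ⟨h1, h2⟩ := hp
  obtain ⟨h3, h4⟩ := hθ
  have a1 : 0 < θ := by linarith
  have a2 : 0 < 1 - θ := by linarith
  cases s <;> simp only [sigmaT] <;> split_ifs with h
  · simp
  · rw [mem_Icc, le_div_iff₀ a1, div_le_iff₀ a1]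
    constructor <;> linarith
  · rw [mem_Icc, le_div_iff₀ a2, div_le_iff₀ a2]
    constructor <;> linarith
  · simp

theorem isStrategy1_sigmaStar {p θ₀ : ℝ} (hp : p ∈ Icc (1 / 2 : ℝ) (3 / 4))
    (hθ : θ₀ ∈ Icc (1 - p) p) : IsStrategy1 (sigmaStar p θ₀) := fun _ _ =>
  sigmaT_mem hp (belief_mem hp hθ _) _

/-- Under `σ*` the expected gain depends on the past only through the moves. -/
theorem expGain_sigmaStar_congr (p θ₀ : ℝ) (τ : Strategy2) (n : ℕ) : ∀ h h' s,
    h.map Prod.snd = h'.map Prod.snd →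
    expGain p (sigmaStar p θ₀) τ n h s = expGain p (sigmaStar p θ₀) τ n h' s := by
  induction n with
  | zero => intros; rfl
  | succ n ih =>
    intro h h' s e
    have e1 : (h.map fun e => e.2.1) = h'.map fun e => e.2.1 := by
      have := congrArg (List.map Prod.fst) e
      simpa [Function.comp_def] using this
    have e2 : ∀ a b s', expGain p (sigmaStar p θ₀) τ n ((s, a, b) :: h) s'
        = expGain p (sigmaStar p θ₀) τ n ((s, a, b) :: h') s' := fun a b s' =>
      ih _ _ _ (by simp [e])
    simp only [expGain, sigmaStar, e, e1]
    simp only [e2]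

/-! ### The belief-weighted and the antisymmetric part of `w` -/

/-- The average of `w θ` under the belief `θ`. -/
noncomputable def wMean (p θ : ℝ) : ℝ := θ * wVec p θ 0 + (1 - θ) * wVec p θ 1

/-- The difference of the coordinates of `w θ`. -/
noncomputable def wDiff (p θ : ℝ) : ℝ := wVec p θ 0 - wVec p θ 1

theorem wVec_symm {p : ℝ} (hp : p ∈ Icc (1 / 2 : ℝ) (3 / 4)) (θ : ℝ) :
    wVec p (1 - θ) 0 = wVec p θ 1 ∧ wVec p (1 - θ) 1 = wVec p θ 0 := by
  simp only [wVec_apply hp, (sideProd_symm p _ θ).1, (sideProd_symm p _ θ).2, and_self]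

theorem wMean_symm {p : ℝ} (hp : p ∈ Icc (1 / 2 : ℝ) (3 / 4)) (θ : ℝ) :
    wMean p (1 - θ) = wMean p θ := by
  simp only [wMean, (wVec_symm hp θ).1, (wVec_symm hp θ).2]
  ring

theorem wDiff_symm {p : ℝ} (hp : p ∈ Icc (1 / 2 : ℝ) (3 / 4)) (θ : ℝ) :
    wDiff p (1 - θ) = -wDiff p θ := by
  simp only [wDiff, (wVec_symm hp θ).1, (wVec_symm hp θ).2]
  ring

theorem wMean_nonneg {p : ℝ} (hp : p ∈ Icc (1 / 2 : ℝ) (3 / 4)) (θ : ℝ) : 0 ≤ wMean p θ := by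
  have hs := Pi.summable.1 (summable_wVec hp θ)
  rw [wMean, wVec_apply hp, wVec_apply hp, ← tsum_mul_left, ← tsum_mul_left,
    ← ((hs 0).mul_left θ).tsum_add ((hs 1).mul_left (1 - θ))]
  exact tsum_nonneg fun n => sideProd_nonneg p n θ

theorem wVec_abs_le {p : ℝ} (hp : p ∈ Icc (1 / 2 : ℝ) (3 / 4)) (θ : ℝ) (i : Fin 2) :
    |wVec p θ i| ≤ 40 := by
  have hg := (hasSum_geometric_of_lt_one (r := (19 / 20 : ℝ)) (by norm_num) (by norm_num)).mul_right 2
  rw [show (1 - 19 / 20 : ℝ)⁻¹ * 2 = 40 by norm_num] at hg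
  rw [wVec_apply hp, ← Real.norm_eq_abs]
  refine tsum_of_norm_bounded hg fun n => ?_
  have h := sideProd_bound hp n θ
  rw [Real.norm_eq_abs]
  refine abs_le_of_sq_le_sq ?_ (by positivity)
  fin_cases i <;> simp only [Fin.zero_eta, Fin.mk_one] <;>
    nlinarith [sq_nonneg ((sideProd p n θ).mulVec (fun _ => (1 : ℝ)) 0),
      sq_nonneg ((sideProd p n θ).mulVec (fun _ => (1 : ℝ)) 1), sq_nonneg ((19 / 20 : ℝ) ^ n)]

theorem Phi_of_le {p θ : ℝ} (h : 1 / 2 ≤ θ) : Phi p θ = 3 * p - 1 - gam p / θ := by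
  have : θ ≠ 0 := by linarith
  rw [Phi, fB, if_pos h, if_pos h, gam]
  field_simp
  ring

theorem wMean_half {p : ℝ} (hp : p ∈ Icc (1 / 2 : ℝ) (3 / 4)) :
    wMean p (1 / 2) = 1 + 1 / 2 * wMean p p := by
  have hΦ : Phi p (1 / 2) = 1 - p := by norm_num [Phi, fB]
  simp only [wMean, wVec_step hp (1 / 2), hΦ, sideMat, lt_irrefl, if_false, Matrix.mulVec,
    dotProduct, Fin.sum_univ_two, Matrix.of_apply, Matrix.cons_val', Matrix.cons_val_zero,
    Matrix.cons_val_one, Matrix.cons_val_fin_one, Pi.add_apply, (wVec_symm hp p).1,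
    (wVec_symm hp p).2]
  ring

/-- Forced by oddness. The recursion for the difference therefore fails to extend to `1/2` in
general, unlike the one for the mean. -/
theorem wDiff_half {p : ℝ} (hp : p ∈ Icc (1 / 2 : ℝ) (3 / 4)) : wDiff p (1 / 2) = 0 := by
  have := wDiff_symm hp (1 / 2)
  norm_num at this
  linarith

/-- In this form `xStar p θ` is `1 - v * (wVec p θ 0 - 1)`, so it is a probability exactly when the
bracket lies between `0` and `wMean p p`; the second coordinate governs the action `T` in state
`hi`. -/
theorem wVec_of_gt {p : ℝ} (hp : p ∈ Icc (1 / 2 : ℝ) (3 / 4)) {θ : ℝ} (h : 1 / 2 < θ) :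
    wVec p θ 0 = 1 + (wMean p (Phi p θ) + (p - Phi p θ) * wDiff p (Phi p θ)) ∧
    wVec p θ 1 = 1 - gam p * wDiff p (Phi p θ) := by
  simp only [wVec_step hp θ, sideMat, if_pos h, wMean, wDiff]
  simp only [Matrix.mulVec, dotProduct, Fin.sum_univ_two, Matrix.of_apply, Matrix.cons_val',
    Matrix.cons_val_zero, Matrix.cons_val_one, Matrix.cons_val_fin_one, Pi.add_apply]
  constructor <;> ring

/-- `Phi p θ` is the posterior after an unrevealing `B`, which has probability `θ`; this makes the
difference terms cancel. -/
theorem wMean_of_gt {p : ℝ} (hp : p ∈ Icc (1 / 2 : ℝ) (3 / 4)) {θ : ℝ} (h : 1 / 2 < θ) :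
    wMean p θ = 1 + θ * wMean p (Phi p θ) := by
  have h0 : θ ≠ 0 := by linarith
  have hΦ : θ * Phi p θ = (3 * p - 1) * θ - gam p := by
    rw [Phi_of_le h.le]
    field_simp
  rw [wMean, (wVec_of_gt hp h).1, (wVec_of_gt hp h).2]
  unfold gam at *
  linear_combination -wDiff p (Phi p θ) * hΦ

theorem wDiff_of_gt {p : ℝ} (hp : p ∈ Icc (1 / 2 : ℝ) (3 / 4)) {θ : ℝ} (h : 1 / 2 < θ) :
    wDiff p θ = wMean p (Phi p θ) + (3 * p - 1 - Phi p θ) * wDiff p (Phi p θ) := by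
  rw [wDiff, (wVec_of_gt hp h).1, (wVec_of_gt hp h).2, gam]
  ring

/-! ### Player 1 -/

theorem vStar_eq (p : ℝ) : vStar p = 1 / wMean p p := rfl

theorem one_le_wMean_self {p : ℝ} (hp : p ∈ Icc (1 / 2 : ℝ) (3 / 4)) : 1 ≤ wMean p p :=
  one_le_denom hp

theorem vStar_mul {p : ℝ} (hp : p ∈ Icc (1 / 2 : ℝ) (3 / 4)) : vStar p * wMean p p = 1 := by
  have := one_le_wMean_self hp
  rw [vStar_eq, one_div, inv_mul_cancel₀ (by linarith)]

theorem vStar_mem {p : ℝ} (hp : p ∈ Icc (1 / 2 : ℝ) (3 / 4)) : vStar p ∈ Ioc (0 : ℝ) 1 := by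
  have := one_le_wMean_self hp
  rw [vStar_eq]
  exact ⟨by positivity, (div_le_one (by linarith)).2 this⟩

theorem fT_of_le_half {p θ : ℝ} (h0 : θ ≤ 1 / 2) :
    (1 - θ) * fT p θ = p * θ + (1 - p) * (1 - 2 * θ) := by
  have h1 : (1 : ℝ) - θ ≠ 0 := by linarith
  rcases h0.lt_or_eq with h | rfl
  · rw [fT, if_neg (not_le.2 h)]
    field_simp
  · norm_num [fT]
    ring

theorem fB_of_le_half {p θ : ℝ} (h0 : θ ≤ 1 / 2) : fB p θ = 1 - p := by
  rcases h0.lt_or_eq with h | rfl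
  · rw [fB, if_neg (not_le.2 h)]
  · norm_num [fB]

theorem fB_of_half_le {p θ : ℝ} (h0 : 1 / 2 ≤ θ) :
    θ * fB p θ = p * (2 * θ - 1) + (1 - p) * (1 - θ) := by
  have h1 : θ ≠ 0 := by linarith
  rw [fB, if_pos h0]
  field_simp

theorem wMean_of_le_half {p θ : ℝ} (hp : p ∈ Icc (1 / 2 : ℝ) (3 / 4)) (h0 : θ ≤ 1 / 2) :
    wMean p θ = 1 + (1 - θ) * wMean p (fT p θ) := by
  rcases h0.lt_or_eq with h | rfl
  · rw [← wMean_symm hp, wMean_of_gt hp (by linarith), fT_eq_one_sub_fB h, wMean_symm hp, Phi,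
      if_pos (by linarith)]
  · rw [wMean_half hp, fT, if_pos le_rfl]
    norm_num

theorem sigmaT_of_le_half {θ : ℝ} (h0 : θ ≤ 1 / 2) :
    sigmaT θ .lo = 1 ∧ (1 - θ) * sigmaT θ .hi = 1 - 2 * θ := by
  have h1 : (1 : ℝ) - θ ≠ 0 := by linarith
  simp only [sigmaT, if_pos h0, true_and]
  field_simp

theorem sigmaT_of_half_lt {θ : ℝ} (h0 : 1 / 2 < θ) :
    θ * sigmaT θ .lo = 1 - θ ∧ sigmaT θ .hi = 0 := by
  have h1 : θ ≠ 0 := by linarith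
  simp only [sigmaT, if_neg (not_le.2 h0), and_true]
  field_simp

/-- The expected gain against `σ*` when the internal state is the true belief. -/
theorem le_expGain_sigmaStar_belief {p θ₀ : ℝ} (hp : p ∈ Icc (1 / 2 : ℝ) (3 / 4))
    (hθ₀ : θ₀ ∈ Icc (1 - p) p) {τ : Strategy2} (hτ : IsStrategy2 τ) (n : ℕ) : ∀ h θ,
    belief p θ₀ (h.map fun e => e.2.1) = θ →
    n * vStar p - vStar p * wMean p θ ≤ θ * expGain p (sigmaStar p θ₀) τ n h .lo
      + (1 - θ) * expGain p (sigmaStar p θ₀) τ n h .hi := by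
  induction n with
  | zero =>
    intro h θ _
    have := mul_nonneg (vStar_mem hp).1.le (wMean_nonneg hp θ)
    simp only [expGain, Nat.cast_zero]
    linarith
  | succ n ih =>
    intro h θ hθ
    have hb := belief_mem hp hθ₀ (h.map fun e => e.2.1)
    rw [hθ] at hb
    have hy := hτ (h.map Prod.snd)
    have hv := vStar_mul hp
    -- Merging pasts that differ only in the hidden state lets the two continuations be averaged
    -- with the new belief.
    have hg : ∀ a b, expGain p (sigmaStar p θ₀) τ n ((.hi, a, b) :: h)
        = expGain p (sigmaStar p θ₀) τ n ((.lo, a, b) :: h) := fun a b =>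
      funext fun s => expGain_sigmaStar_congr _ _ _ _ _ _ _ (by simp)
    have keyT := fun b => ih ((.lo, .T, b) :: h) _ rfl
    have keyB := fun b => ih ((.lo, .B, b) :: h) _ rfl
    simp only [List.map_cons, belief, hθ] at keyT keyB
    have kT := add_le_add (mul_le_mul_of_nonneg_left (keyT .L) hy.1)
      (mul_le_mul_of_nonneg_left (keyT .R) (sub_nonneg.2 hy.2))
    have kB := add_le_add (mul_le_mul_of_nonneg_left (keyB .L) hy.1)
      (mul_le_mul_of_nonneg_left (keyB .R) (sub_nonneg.2 hy.2))
    clear keyT keyB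
    have c1 : 0 < θ := by linarith [hb.1, hp.2]
    have c2 : 0 < 1 - θ := by linarith [hb.2, hp.2]
    simp only [expGain, sigmaStar, hθ, hg, Sys.flip, stageGain]
    generalize τ (h.map Prod.snd) = y at *
    generalize expGain p (sigmaStar p θ₀) τ n ((.lo, .T, .L) :: h) = eTL at *
    generalize expGain p (sigmaStar p θ₀) τ n ((.lo, .T, .R) :: h) = eTR at *
    generalize expGain p (sigmaStar p θ₀) τ n ((.lo, .B, .L) :: h) = eBL at *
    generalize expGain p (sigmaStar p θ₀) τ n ((.lo, .B, .R) :: h) = eBR at *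
    simp only [mix]
    push_cast
    rcases le_or_gt θ (1 / 2) with hh | hh
    · obtain ⟨s1, s2⟩ := sigmaT_of_le_half hh
      have f1 := fT_of_le_half (p := p) hh
      rw [fB_of_le_half hh, wMean_symm hp] at kB
      rw [wMean_of_le_half hp hh, s1]
      -- Averaged over the belief, `σ*` plays `T` with probability `1 - θ` and `B` with probability
      -- `θ`, here and in the other case. The terms with `s1`, `s2`, `f1` convert the probabilities
      -- given the state into posteriors.
      have k1 := mul_le_mul_of_nonneg_left kT c2.le
      have k2 := mul_le_mul_of_nonneg_left kB c1.le
      generalize sigmaT θ .hi = t at *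
      generalize wMean p (fT p θ) = w at *
      generalize fT p θ = f at *
      linear_combination k1 + k2 + θ * hv + f1 * (y * (eTL .lo - eTL .hi)
        + (1 - y) * (eTR .lo - eTR .hi)) + s2 * (- (y * (p * eTL .hi + (1 - p) * eTL .lo)
        + (1 - y) * (p * eTR .hi + (1 - p) * eTR .lo)) + y * (p * eBL .hi + (1 - p) * eBL .lo)
        + (1 - y) * (1 + p * eBR .hi + (1 - p) * eBR .lo))
    · obtain ⟨s1, s2⟩ := sigmaT_of_half_lt hh
      have f1 := fB_of_half_le (p := p) hh.le
      rw [fT, if_pos hh.le] at kT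
      rw [wMean_of_gt hp hh, s2, Phi, if_pos hh.le]
      have k1 := mul_le_mul_of_nonneg_left kT c2.le
      have k2 := mul_le_mul_of_nonneg_left kB c1.le
      generalize sigmaT θ .lo = t at *
      generalize wMean p (fB p θ) = w at *
      generalize fB p θ = f at *
      linear_combination k1 + k2 + (1 - θ) * hv + f1 * (y * (eBL .lo - eBL .hi)
        + (1 - y) * (eBR .lo - eBR .hi)) + s1 * (y * (p * eBL .lo + (1 - p) * eBL .hi)
        + (1 - y) * (p * eBR .lo + (1 - p) * eBR .hi) - y * (1 + p * eTL .lo + (1 - p) * eTL .hi)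
        - (1 - y) * (p * eTR .lo + (1 - p) * eTR .hi))

/-- Bound on the expected loss under `σ*` until the internal state becomes the true belief. -/
noncomputable def lossBound (θ : ℝ) : Sys → ℝ
  | .lo => if θ ≤ 1 / 2 then 18 else 14
  | .hi => if θ ≤ 1 / 2 then 14 else 18

theorem lossBound_nonneg (θ : ℝ) (s : Sys) : 0 ≤ lossBound θ s := by
  cases s <;> simp only [lossBound] <;> split_ifs <;> norm_num

theorem lossBound_le (θ : ℝ) (s : Sys) : lossBound θ s ≤ 18 := by
  cases s <;> simp only [lossBound] <;> split_ifs <;> norm_num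

theorem mix_lossBound_le {p : ℝ} (hp : p ∈ Icc (1 / 2 : ℝ) (3 / 4)) (θ : ℝ) (s : Sys) :
    mix p (lossBound θ s) (lossBound θ s.flip) ≤ 17 := by
  cases s <;> simp only [lossBound, Sys.flip, mix] <;> split_ifs <;> linarith [hp.1, hp.2]

/-- The loss is `14` in the state where `σ*` reveals with probability at least `1/3` and `18` in the
other. If nothing is revealed, the next stage starts with an expected loss of at most `17`, as `p ≤
3/4`; this closes the second case since `v ≤ 1`. After a revelation the loss is `v * wMean p p = 1`,
and `2/3 * 17 + 1/3 * 1 + 1 ≤ 14` closes the first. -/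
theorem le_expGain_sigmaStar {p θ₀ : ℝ} (hp : p ∈ Icc (1 / 2 : ℝ) (3 / 4))
    (hθ₀ : θ₀ ∈ Icc (1 - p) p) {τ : Strategy2} (hτ : IsStrategy2 τ) (n : ℕ) : ∀ h s,
    n * vStar p - lossBound (belief p θ₀ (h.map fun e => e.2.1)) s
      ≤ expGain p (sigmaStar p θ₀) τ n h s := by
  induction n with
  | zero =>
    intro h s
    simp only [expGain, Nat.cast_zero]
    linarith [lossBound_nonneg (belief p θ₀ (h.map fun e => e.2.1)) s]
  | succ n ih =>
    intro h s
    have hp01 : p ∈ Icc (0 : ℝ) 1 := ⟨by linarith [hp.1], by linarith [hp.2]⟩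
    have hb := belief_mem hp hθ₀ (h.map fun e => e.2.1)
    have hy := hτ (h.map Prod.snd)
    have hv := vStar_mem hp
    have hv1 := vStar_mul hp
    have hgain : ∀ s a b, 0 ≤ stageGain s a b := by
      intro s a b
      cases s <;> cases a <;> cases b <;> simp [stageGain]
    -- an uninformative action
    have key : ∀ a b, n * vStar p - 17 ≤ stageGain s a b
        + mix p (expGain p (sigmaStar p θ₀) τ n ((s, a, b) :: h) s)
          (expGain p (sigmaStar p θ₀) τ n ((s, a, b) :: h) s.flip) := by
      intro a b
      have h1 := mix_le_mix hp01 (ih ((s, a, b) :: h) s) (ih ((s, a, b) :: h) s.flip)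
      have h2 := mix_lossBound_le hp (belief p θ₀ (((s, a, b) :: h).map fun e => e.2.1)) s
      have h3 := hgain s a b
      unfold mix at h1 h2 ⊢
      linarith
    -- an action that reveals the state
    have resetT := fun b => le_expGain_sigmaStar_belief hp hθ₀ hτ n ((s, .T, b) :: h) _ rfl
    have resetB := fun b => le_expGain_sigmaStar_belief hp hθ₀ hτ n ((s, .B, b) :: h) _ rfl
    simp only [List.map_cons, belief] at resetT resetB
    have hstep : ∀ {c : ℝ} a, (∀ b, c ≤ stageGain s a b
        + mix p (expGain p (sigmaStar p θ₀) τ n ((s, a, b) :: h) s)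
          (expGain p (sigmaStar p θ₀) τ n ((s, a, b) :: h) s.flip)) →
        c ≤ mix (τ (h.map Prod.snd)) (stageGain s a .L
        + mix p (expGain p (sigmaStar p θ₀) τ n ((s, a, .L) :: h) s)
          (expGain p (sigmaStar p θ₀) τ n ((s, a, .L) :: h) s.flip)) (stageGain s a .R
        + mix p (expGain p (sigmaStar p θ₀) τ n ((s, a, .R) :: h) s)
          (expGain p (sigmaStar p θ₀) τ n ((s, a, .R) :: h) s.flip)) := by
      intro c a hc
      rw [← mix_self (τ (h.map Prod.snd)) c]
      exact mix_le_mix hy (hc _) (hc _)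
    have kT := hstep .T (key .T)
    have kB := hstep .B (key .B)
    simp only [expGain]
    rw [sigmaStar]
    generalize belief p θ₀ (h.map fun e => e.2.1) = θ at *
    have hσ := fun s => sigmaT_mem hp hb s
    have c1 : 0 < θ := by linarith [hb.1, hp.2]
    have c2 : 0 < 1 - θ := by linarith [hb.2, hp.2]
    push_cast
    rcases le_or_gt θ (1 / 2) with hh | hh
    · obtain ⟨s1, s2⟩ := sigmaT_of_le_half hh
      cases s with
      | lo =>
        have := mix_le_mix (hσ .lo) kT kB
        rw [mix_self] at this
        simp only [lossBound, if_pos hh]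
        linarith [hv.2]
      | hi =>
        have kB' := hstep .B (c := n * vStar p - 1) fun b => by
          have h1 := resetB b
          rw [fB_of_le_half hh, wMean_symm hp] at h1
          have h3 := hgain .hi .B b
          simp only [mix, Sys.flip]
          linarith
        refine le_trans ?_ (mix_le_mix (hσ .hi) kT kB')
        have ht : sigmaT θ .hi ≤ 2 / 3 := by nlinarith [hb.1, hp.2]
        simp only [lossBound, if_pos hh, mix]
        linarith [hv.2]
    · obtain ⟨s1, s2⟩ := sigmaT_of_half_lt hh
      cases s with
      | hi =>
        have := mix_le_mix (hσ .hi) kT kB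
        rw [mix_self] at this
        simp only [lossBound, if_neg (not_le.2 hh)]
        linarith [hv.2]
      | lo =>
        have kT' := hstep .T (c := n * vStar p - 1) fun b => by
          have h1 := resetT b
          rw [fT, if_pos hh.le] at h1
          have h3 := hgain .lo .T b
          simp only [mix, Sys.flip]
          linarith
        refine le_trans ?_ (mix_le_mix (hσ .lo) kT' kB)
        have ht : 1 / 3 ≤ sigmaT θ .lo := by nlinarith [hb.2, hp.2]
        simp only [lossBound, if_neg (not_le.2 hh), mix]
        linarith [hv.2]

theorem guarantees1_sigmaStar {p q θ₀ : ℝ} (hp : p ∈ Icc (1 / 2 : ℝ) (3 / 4))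
    (hq : q ∈ Icc (0 : ℝ) 1) (hθ₀ : θ₀ ∈ Icc (1 - p) p) :
    Guarantees1 p q (sigmaStar p θ₀) (vStar p) :=
  guarantees1_of_bound (C := 18) hq fun τ hτ n s => by
    have h1 := le_expGain_sigmaStar hp hθ₀ hτ n [] s
    have h2 := lossBound_le (belief p θ₀ (([] : List (Sys × Act1 × Act2)).map fun e => e.2.1)) s
    linarith

/-! ### Bounds for the folded system -/

/-- The recursion for the mean `m` and the difference `d` on `[1/2, p]`, after folding `[1 - p, p]` at
`1/2`, where `p = (k + 2) / 3` and `γ = (2 k + 1) / 3`. -/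
structure FoldedSystem (k : ℝ) (m d : ℝ → ℝ) : Prop where
  k_nonneg : 0 ≤ k
  k_le : k ≤ 0.15707
  low : ∀ x, 1 / 2 ≤ x → x < 2 / 3 → ∃ z, 1 / 2 < z ∧ z ≤ (k + 2) / 3 ∧
    x * (z + k) = (2 * k + 1) / 3 ∧ m x = 1 + x * m z ∧ (1 / 2 < x → d x = m z - (z + k) * d z)
  high : ∀ x, 2 / 3 ≤ x → x ≤ (k + 2) / 3 → ∃ y, 1 / 2 ≤ y ∧ y < 2 / 3 ∧
    y * (k + 2) ≤ k ^ 2 + k + 1 ∧ x * (k + 1 - y) = (2 * k + 1) / 3 ∧ m x = 1 + x * m y ∧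
    d x = m y + (k + 1 - y) * d y
  d_half : d (1 / 2) = 0
  bound : ∃ C, ∀ x, 1 / 2 ≤ x → x ≤ (k + 2) / 3 → |m x| ≤ C ∧ |d x| ≤ C

/-- Replaces a fixed-point argument: an a priori bound with error `C` and one contracting step give
the bound with arbitrarily small error. -/
theorem exists_small_of_contracts {Q : ℝ → Prop} {C : ℝ} (hC : 0 ≤ C) (h0 : Q C)
    (h : ∀ e, 0 ≤ e → Q e → Q (9 / 10 * e)) {ε : ℝ} (hε : 0 < ε) : ∃ e, 0 ≤ e ∧ e < ε ∧ Q e := by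
  have hn : ∀ n : ℕ, Q ((9 / 10) ^ n * C) := by
    intro n
    induction n with
    | zero => simpa using h0
    | succ n ih =>
      have := h _ (by positivity) ih
      rwa [pow_succ', mul_assoc]
  have ht : Tendsto (fun n : ℕ => (9 / 10 : ℝ) ^ n * C) atTop (nhds (0 * C)) :=
    (tendsto_pow_atTop_nhds_zero_of_lt_one (by norm_num) (by norm_num)).mul_const C
  rw [zero_mul] at ht
  obtain ⟨n, hn'⟩ := (ht.eventually (gt_mem_nhds hε)).exists
  exact ⟨_, by positivity, hn', hn n⟩

/-- The lower bound for `m`. -/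
noncomputable def mLow (k : ℝ) : ℝ := 9 / (4 - k)

/-- The upper bound for `m`. -/
noncomputable def mUp (k : ℝ) : ℝ := (k + 5) / ((k + 2) * (1 - k))

/-- The upper bound for `d`. -/
noncomputable def dUp (k : ℝ) : ℝ := 3 * (k + 5) / ((4 - k) * (2 * k + 1))

/-! ### Rational inequalities in `k` for the three constants -/

section numeric
variable {k : ℝ}

theorem mLow_mul (h : k ≤ 0.15707) : mLow k * (4 - k) = 9 :=
  div_mul_cancel₀ _ (by linarith)

theorem mUp_mul (h0 : 0 ≤ k) (h : k ≤ 0.15707) : mUp k * ((k + 2) * (1 - k)) = k + 5 :=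
  div_mul_cancel₀ _ (mul_pos (by linarith) (by linarith)).ne'

theorem mLow_ge (h0 : 0 ≤ k) (h : k ≤ 0.15707) : 9 / 4 + 9 / 16 * k ≤ mLow k := by
  rw [mLow, le_div_iff₀ (by linarith)]
  nlinarith

theorem mLow_le (h0 : 0 ≤ k) (h : k ≤ 0.15707) : mLow k ≤ 9 / 4 + 3 / 5 * k := by
  rw [mLow, div_le_iff₀ (by linarith)]
  nlinarith

theorem mUp_ge (h0 : 0 ≤ k) (h : k ≤ 0.15707) : 5 / 2 ≤ mUp k := by
  rw [mUp, le_div_iff₀ (mul_pos (by linarith) (by linarith))]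
  nlinarith

theorem mUp_le (h0 : 0 ≤ k) (h : k ≤ 0.15707) : mUp k ≤ 5 / 2 + 43 / 20 * k := by
  rw [mUp, div_le_iff₀ (mul_pos (by linarith) (by linarith))]
  nlinarith [mul_nonneg h0 (sub_nonneg.2 h), mul_nonneg (mul_nonneg h0 h0) (sub_nonneg.2 h)]

theorem mUp_le_dUp (h0 : 0 ≤ k) (h : k ≤ 0.15707) : mUp k ≤ dUp k := by
  rw [mUp, dUp, div_le_div_iff₀ (mul_pos (by linarith) (by linarith))
    (mul_pos (by linarith) (by linarith))]
  nlinarith [mul_nonneg h0 (sub_nonneg.2 h), mul_nonneg (mul_nonneg h0 h0) (sub_nonneg.2 h)]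

/-- `1 + p · mLow = 2 γ · dUp`. -/
theorem dUp_eq (h0 : 0 ≤ k) (h : k ≤ 0.15707) :
    1 + (k + 2) / 3 * mLow k = 2 * ((2 * k + 1) / 3) * dUp k := by
  have h1 : (4 - k) ≠ 0 := by linarith
  have h2 : 2 * k + 1 ≠ 0 := by linarith
  rw [mLow, dUp]
  field_simp
  ring

theorem mUp_low_le (h0 : 0 ≤ k) (h : k ≤ 0.15707) :
    5 / 3 + mUp k / 3 ≤ 1 + (k + 2) / 3 * mLow k := by
  have h1 := mUp_le h0 h
  have h2 := mul_le_mul_of_nonneg_left (mLow_ge h0 h) (show 0 ≤ (k + 2) / 3 by linarith)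
  nlinarith

/-- Closes the pattern high, low, high in `diff_step`. -/
theorem dUp_bound_high (h0 : 0 ≤ k) (h : k ≤ 0.15707) :
    k + 2 + (1 / 3 - k / 3 - k ^ 2) * (5 / 3 + mUp k / 3) ≤ dUp k := by
  have h1 := mUp_le h0 h
  have hC : 0 ≤ 1 / 3 - k / 3 - k ^ 2 := by nlinarith
  refine (add_le_add_right (mul_le_mul_of_nonneg_left
    (show 5 / 3 + mUp k / 3 ≤ 5 / 2 + 43 / 60 * k by linarith) hC) _).trans ?_
  rw [dUp, le_div_iff₀ (mul_pos (by linarith) (by linarith))]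
  nlinarith [mul_nonneg h0 (sub_nonneg.2 h), mul_nonneg (mul_nonneg h0 h0) (sub_nonneg.2 h),
    mul_nonneg (pow_nonneg h0 3) (sub_nonneg.2 h), mul_nonneg (pow_nonneg h0 4) (sub_nonneg.2 h)]

/-- Closes the pattern high, low, low in `high_low_low_le`; the last term on the left bounds the
contribution of `d` after these three steps. -/
theorem dUp_bound_low (h0 : 0 ≤ k) (h : k ≤ 0.15707) :
    k + 2 + (1 / 3 - k / 3 - k ^ 2) * (1 + (1 / 2 + k / 4) * mUp k)
      + (2 * k + 1) ^ 3 / (3 * (k + 2)) * (1 - k * mLow k) ≤ dUp k := by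
  have h1 := mUp_le h0 h
  have h2 := mLow_ge h0 h
  have hC : 0 ≤ 1 / 3 - k / 3 - k ^ 2 := by nlinarith
  have e1 : (1 / 3 - k / 3 - k ^ 2) * (1 + (1 / 2 + k / 4) * mUp k)
      ≤ (1 / 3 - k / 3 - k ^ 2) * (1 + (1 / 2 + k / 4) * (5 / 2 + 43 / 20 * k)) := by
    gcongr
  have e2 : (2 * k + 1) ^ 3 / (3 * (k + 2)) * (1 - k * mLow k)
      ≤ (2 * k + 1) ^ 3 / (3 * (k + 2)) * (1 - k * (9 / 4 + 9 / 16 * k)) := by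
    gcongr
  have e3 : (2 * k + 1) ^ 3 / (3 * (k + 2)) * (1 - k * (9 / 4 + 9 / 16 * k)) ≤ 1 / 6 + k * (11 / 20) - 9 / 10 * k ^ 2 := by
    rw [div_mul_eq_mul_div, div_le_iff₀ (by linarith)]
    nlinarith [mul_nonneg h0 (sq_nonneg (k - 0.043)), pow_nonneg h0 4, pow_nonneg h0 5]
  have e4 : k + 2 + (1 / 3 - k / 3 - k ^ 2) * (1 + (1 / 2 + k / 4) * (5 / 2 + 43 / 20 * k))
      + (1 / 6 + k * (11 / 20) - 9 / 10 * k ^ 2) ≤ dUp k := by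
    rw [dUp, le_div_iff₀ (mul_pos (by linarith) (by linarith))]
    nlinarith [mul_nonneg h0 (sub_nonneg.2 h), mul_nonneg (mul_nonneg h0 h0) (sub_nonneg.2 h),
    mul_nonneg (pow_nonneg h0 3) (sub_nonneg.2 h), mul_nonneg (pow_nonneg h0 4) (sub_nonneg.2 h)]
  linarith

/-- This and `lowProb_bound_low` play the same role in `add_diff_mem`, that is, for `0 ≤ xStar p θ`
when `θ ≥ 2/3`. -/
theorem lowProb_bound_high (h0 : 0 ≤ k) (h : k ≤ 0.15707) :
    (k + 2) / 3 + ((2 * k + 1) / 3 - (k + 2) / 3 * k) * (5 / 3 + mUp k / 3)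
      ≤ (k + 2) / 3 * mLow k := by
  have h1 := mUp_le h0 h
  have h2 := mul_le_mul_of_nonneg_left (mLow_ge h0 h) (show 0 ≤ (k + 2) / 3 by linarith)
  have hC : 0 ≤ (2 * k + 1) / 3 - (k + 2) / 3 * k := by nlinarith
  have e1 := mul_le_mul_of_nonneg_left
    (show 5 / 3 + mUp k / 3 ≤ 5 / 2 + 43 / 60 * k by linarith) hC
  nlinarith [mul_nonneg h0 (sub_nonneg.2 h), mul_nonneg (mul_nonneg h0 h0) (sub_nonneg.2 h)]

theorem lowProb_bound_low (h0 : 0 ≤ k) (h : k ≤ 0.15707) :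
    (k + 2) / 3 + ((2 * k + 1) / 3 - (k + 2) / 3 * k) * (1 + (1 / 2 + k / 4) * mUp k)
      + ((2 * k + 1) / 3) ^ 2 * (1 / 2 + k * (5 / 4)) * (1 - k * mLow k) ≤ (k + 2) / 3 * mLow k := by
  have h1 := mUp_le h0 h
  have h2 := mLow_ge h0 h
  have hC : 0 ≤ (2 * k + 1) / 3 - (k + 2) / 3 * k := by nlinarith
  have e0 := mul_le_mul_of_nonneg_left h2 (show 0 ≤ (k + 2) / 3 by linarith)
  have e1 : ((2 * k + 1) / 3 - (k + 2) / 3 * k) * (1 + (1 / 2 + k / 4) * mUp k)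
      ≤ ((2 * k + 1) / 3 - (k + 2) / 3 * k) * (1 + (1 / 2 + k / 4) * (5 / 2 + 43 / 20 * k)) := by
    gcongr
  have e2 : ((2 * k + 1) / 3) ^ 2 * (1 / 2 + k * (5 / 4)) * (1 - k * mLow k)
      ≤ ((2 * k + 1) / 3) ^ 2 * (1 / 2 + k * (5 / 4)) * (1 - k * (9 / 4 + 9 / 16 * k)) := by
    gcongr
  nlinarith [mul_nonneg h0 (sub_nonneg.2 h), mul_nonneg (mul_nonneg h0 h0) (sub_nonneg.2 h),
    mul_nonneg (pow_nonneg h0 3) (sub_nonneg.2 h), mul_nonneg (pow_nonneg h0 4) (sub_nonneg.2 h)]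

end numeric

/-! ### Bounds for the mean and the difference -/

namespace FoldedSystem

variable {k : ℝ} {m d : ℝ → ℝ}

theorem exists_step (H : FoldedSystem k m d) {x : ℝ} (h1 : 1 / 2 ≤ x) (h2 : x ≤ (k + 2) / 3) :
    ∃ y, 1 / 2 ≤ y ∧ y ≤ (k + 2) / 3 ∧ m x = 1 + x * m y := by
  rcases lt_or_ge x (2 / 3) with h | h
  · obtain ⟨z, z1, z2, -, z3, -⟩ := H.low x h1 h
    exact ⟨z, z1.le, z2, z3⟩
  · obtain ⟨y, y1, y2, -, -, y3, -⟩ := H.high x h h2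
    exact ⟨y, y1, by linarith [H.k_nonneg], y3⟩

/-- A low step and any further step give `m x = 1 + x + (γ - k x) * m y`. With `mLow` for `m y` this
is nondecreasing in `x`, so the worst case is `x = 1/2`, and `mLow` is the fixed point there. On the
high branch one step suffices. -/
theorem mLow_le_apply (H : FoldedSystem k m d) {x : ℝ} (h1 : 1 / 2 ≤ x) (h2 : x ≤ (k + 2) / 3) :
    mLow k ≤ m x := by
  have k0 := H.k_nonneg
  have k1 := H.k_le
  have hL := mLow_mul k1
  have l1 := mLow_ge k0 k1
  have l2 := mLow_le k0 k1
  have step : ∀ e, 0 ≤ e → (∀ x, 1 / 2 ≤ x → x ≤ (k + 2) / 3 → mLow k - e ≤ m x) →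
      ∀ x, 1 / 2 ≤ x → x ≤ (k + 2) / 3 → mLow k - (9 / 10 * e) ≤ m x := by
    clear! x
    intro e e0 he x h1 h2
    rcases lt_or_ge x (2 / 3) with h | h
    · obtain ⟨z, z1, z2, z3, z4, -⟩ := H.low x h1 h
      obtain ⟨y, y1, y2, y3⟩ := H.exists_step z1.le z2
      have hy := he y y1 y2
      have hxz : 0 ≤ x * z := by positivity
      have h3 := mul_le_mul_of_nonneg_left hy hxz
      have h4 : x * z ≤ 9 / 10 := by nlinarith
      have h5 := mul_le_mul_of_nonneg_right h4 e0
      have h6 : 0 ≤ (x - 1 / 2) * (1 - k * mLow k) := mul_nonneg (by linarith) (by nlinarith)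
      have h7 : x * z = (2 * k + 1) / 3 - k * x := by linarith
      have h8 : m x = 1 + x + x * z * m y := by rw [z4, y3]; ring
      have h9 : x * z * mLow k = ((2 * k + 1) / 3 - k * x) * mLow k := by rw [h7]
      linarith
    · obtain ⟨y, y1, y2, -, -, y4, -⟩ := H.high x h h2
      have hy := he y y1 (by linarith)
      have h3 := mul_le_mul_of_nonneg_left hy (show 0 ≤ x by linarith)
      have h5 := mul_le_mul_of_nonneg_right (show x ≤ 9 / 10 by linarith) e0
      have h6 := mul_le_mul_of_nonneg_right h (show 0 ≤ mLow k by linarith)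
      linarith
  obtain ⟨C, hC⟩ := H.bound
  have hC0 : 0 ≤ C := (abs_nonneg _).trans (hC x h1 h2).1
  refine le_of_forall_pos_lt_add fun ε hε => ?_
  obtain ⟨e, -, e1, he⟩ := exists_small_of_contracts (add_nonneg (show 0 ≤ mLow k by linarith) hC0)
    (fun x h1 h2 => by linarith [neg_le_of_abs_le (hC x h1 h2).1]) step hε
  linarith [he x h1 h2]

/-- `mUp` is the fixed point of the two-step recursion at `x = p`, the worst case of the high
branch, where `x * y = (k + 1) * x - γ`. For the low branch the worst case is `x = 2/3`. -/
theorem apply_le_mUp (H : FoldedSystem k m d) {x : ℝ} (h1 : 1 / 2 ≤ x) (h2 : x ≤ (k + 2) / 3) :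
    m x ≤ mUp k := by
  have k0 := H.k_nonneg
  have k1 := H.k_le
  have hM := mUp_mul k0 k1
  have l1 := mUp_ge k0 k1
  have l2 := mUp_le k0 k1
  have step : ∀ e, 0 ≤ e → (∀ x, 1 / 2 ≤ x → x ≤ (k + 2) / 3 → m x ≤ mUp k + e) →
      ∀ x, 1 / 2 ≤ x → x ≤ (k + 2) / 3 → m x ≤ mUp k + (9 / 10 * e) := by
    clear! x
    intro e e0 he x h1 h2
    rcases lt_or_ge x (2 / 3) with h | h
    · obtain ⟨z, z1, z2, z3, z4, -⟩ := H.low x h1 h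
      obtain ⟨y, y1, y2, y3⟩ := H.exists_step z1.le z2
      have hy := he y y1 y2
      have hxz : 0 ≤ x * z := by positivity
      have h3 := mul_le_mul_of_nonneg_left hy hxz
      have h4 : x * z ≤ 9 / 10 := by nlinarith
      have h5 := mul_le_mul_of_nonneg_right h4 e0
      have h6 : 0 ≤ (2 / 3 - x) * (1 - k * mUp k) := mul_nonneg (by linarith) (by nlinarith)
      have h7 : x * z = (2 * k + 1) / 3 - k * x := by linarith
      have h8 : m x = 1 + x + x * z * m y := by rw [z4, y3]; ring
      have h9 : x * z * mUp k = ((2 * k + 1) / 3 - k * x) * mUp k := by rw [h7]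
      linarith
    · obtain ⟨y, y1, y2, -, y3, y4, -⟩ := H.high x h h2
      obtain ⟨z, z1, z2, z3⟩ := H.exists_step y1 (by linarith)
      have hz := he z z1 z2
      have hxy : 0 ≤ x * y := mul_nonneg (by linarith) (by linarith)
      have h3 := mul_le_mul_of_nonneg_left hz hxy
      have h7 : x * y = (k + 1) * x - (2 * k + 1) / 3 := by linarith
      have h4 : x * y ≤ (k ^ 2 + k + 1) / 3 := by nlinarith
      have h5 := mul_le_mul_of_nonneg_right (show x * y ≤ 9 / 10 by nlinarith) e0
      have h8 : m x = 1 + x + x * y * m z := by rw [y4, z3]; ring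
      have h6 := mul_le_mul_of_nonneg_right h4 (show 0 ≤ mUp k by linarith)
      linarith
  obtain ⟨C, hC⟩ := H.bound
  have hC0 : 0 ≤ C := (abs_nonneg _).trans (hC x h1 h2).1
  refine le_of_forall_pos_lt_add fun ε hε => ?_
  obtain ⟨e, -, e1, he⟩ := exists_small_of_contracts hC0
    (fun x h1 h2 => by linarith [le_of_abs_le (hC x h1 h2).1]) step hε
  linarith [he x h1 h2]

theorem apply_le_of_lt (H : FoldedSystem k m d) {x : ℝ} (h1 : 1 / 2 ≤ x) (h : x < 2 / 3) :
    m x ≤ 5 / 3 + mUp k / 3 := by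
  have k0 := H.k_nonneg
  have k1 := H.k_le
  have l2 := mUp_le k0 k1
  have l1 := mUp_ge k0 k1
  obtain ⟨z, z1, z2, z3, z4, -⟩ := H.low x h1 h
  obtain ⟨y, y1, y2, y3⟩ := H.exists_step z1.le z2
  have hy := H.apply_le_mUp y1 y2
  have hxz : 0 ≤ x * z := by positivity
  have h3 := mul_le_mul_of_nonneg_left hy hxz
  have h6 : 0 ≤ (2 / 3 - x) * (1 - k * mUp k) := mul_nonneg (by linarith) (by nlinarith)
  have h7 : x * z = (2 * k + 1) / 3 - k * x := by linarith
  have h8 : m x = 1 + x + x * z * m y := by rw [z4, y3]; ring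
  have h9 : x * z * mUp k = ((2 * k + 1) / 3 - k * x) * mUp k := by rw [h7]
  linarith

/-- Three low steps `y ↦ z ↦ w ↦ v` that start below the image of `p` end above `2 / 3`. -/
theorem two_thirds_le_of_chain (k0 : 0 ≤ k) (k1 : k ≤ 0.15707) {y z w v : ℝ} (hy : 1 / 2 ≤ y)
    (hz : 1 / 2 < z) (hw : 1 / 2 < w)
    (h1 : y * (k + 2) ≤ k ^ 2 + k + 1) (h2 : y * (z + k) = (2 * k + 1) / 3)
    (h3 : z * (w + k) = (2 * k + 1) / 3) (h4 : w * (v + k) = (2 * k + 1) / 3) : 2 / 3 ≤ v := by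
  by_contra! hv
  have a1 : (2 * k + 1) < w * (3 * k + 2) := by nlinarith
  have a2 : z * ((3 * k + 1) * (k + 1)) < (2 * k + 1) / 3 * (3 * k + 2) := by nlinarith
  have a3 : (2 * k + 1) * ((3 * k + 1) * (k + 1))
      < y * (9 * k ^ 3 + 18 * k ^ 2 + 10 * k + 2) := by nlinarith
  have a4 : (2 * k + 1) * ((3 * k + 1) * (k + 1)) * (k + 2)
      < (k ^ 2 + k + 1) * (9 * k ^ 3 + 18 * k ^ 2 + 10 * k + 2) := by
    have b1 := mul_lt_mul_of_pos_right a3 (show 0 < k + 2 by linarith)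
    have b2 := mul_le_mul_of_nonneg_right h1
      (show 0 ≤ 9 * k ^ 3 + 18 * k ^ 2 + 10 * k + 2 by positivity)
    linarith
  -- The factor `k` is unavoidable: at `k = 0` the chain is the cycle `1/2, 2/3, 1/2, 2/3` and the
  -- inequalities degenerate to equalities.
  have a5 : 0 ≤ k * (1 - 2 * k - 14 * k ^ 2 - 21 * k ^ 3 - 9 * k ^ 4) := by
    have b2 : k ^ 2 ≤ 0.15707 ^ 2 := by gcongr
    have b3 : k ^ 3 ≤ 0.15707 ^ 3 := by gcongr
    have b4 : k ^ 4 ≤ 0.15707 ^ 4 := by gcongr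
    refine mul_nonneg k0 ?_
    norm_num at b2 b3 b4 k1
    linarith
  nlinarith

/-- Below the image of `p`, two low steps in a row are followed by a third and then by a high one. -/
theorem low_chain (H : FoldedSystem k m d) {y z : ℝ} (hy : 1 / 2 ≤ y)
    (h1 : y * (k + 2) ≤ k ^ 2 + k + 1) (h2 : y * (z + k) = (2 * k + 1) / 3)
    (hz : 1 / 2 < z) (hz' : z < 2 / 3)
    {e : ℝ} (e0 : 0 ≤ e) (he : ∀ u, 1 / 2 ≤ u → u < 2 / 3 → -e ≤ d u) :
    ∃ w, 1 / 2 < w ∧ w ≤ 1 / 2 + k / 4 ∧ z * (w + k) = (2 * k + 1) / 3 ∧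
      m z = 1 + z * m w ∧ d z = m w - (w + k) * d w ∧ m w ≤ 1 + (1 / 2 + k / 4) * mUp k ∧
      d w ≤ 1 - k * mLow k + 66 / 100 * e := by
  have k0 := H.k_nonneg
  have k1 := H.k_le
  obtain ⟨w, w1, w2, w3, w4, w5⟩ := H.low z hz.le hz'
  have w6 : w < 2 / 3 := by
    -- A large `w` makes `z` small and hence `y` large, against `y ≤ 0.56`, which holds below the
    -- image of `p`.
    by_contra! hw
    have a1 : z * (3 * k + 2) ≤ 2 * k + 1 := by nlinarith
    have a2 : y ≤ 0.56 := by nlinarith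
    have a3 : (2 * k + 1) / 3 ≤ 0.56 * (z + k) := by nlinarith
    nlinarith
  obtain ⟨v, v1, v2, v3, v4, v5⟩ := H.low w w1.le w6
  have v6 := two_thirds_le_of_chain k0 k1 hy hz w1 h1 h2 w3 v3
  obtain ⟨u, u1, u2, -, -, u3, u4⟩ := H.high v v6 v2
  have w7 : w ≤ 1 / 2 + k / 4 := by nlinarith
  refine ⟨w, w1, w7, w3, w4, w5 hz, ?_, ?_⟩
  · have := H.apply_le_mUp v1.le v2
    have := H.mLow_le_apply v1.le v2
    have := mLow_ge k0 k1
    rw [v4]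
    exact add_le_add le_rfl (mul_le_mul w7 (by linarith) (by linarith) (by linarith))
  · have mu := H.mLow_le_apply u1 (by linarith)
    have a1 := mul_le_mul_of_nonneg_left (he u u1 u2)
      (mul_nonneg (show 0 ≤ v + k by linarith) (show 0 ≤ k + 1 - u by linarith))
    have a2 := mul_le_mul (show v + k ≤ 1 by linarith) (show k + 1 - u ≤ 66 / 100 by linarith)
      (by linarith) (by norm_num)
    have a3 := mul_le_mul_of_nonneg_right a2 e0
    have a4 := mul_le_mul_of_nonneg_left mu k0
    -- The terms in `m u` collapse: `d w = 1 - k * m u - (v + k) * (k + 1 - u) * d u`.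
    rw [v5 w1, u4, u3]
    linarith

/-- Multiplied by `y * z = γ - k * y`, the weight becomes `(k + 1 - y) * γ ^ 2`. The resulting
quotient is largest at `y = 1/2`, which gives the right side. -/
theorem chain_weight_le (k0 : 0 ≤ k) (k1 : k ≤ 0.15707) {y z w : ℝ} (hy : 1 / 2 ≤ y)
    (hz : 1 / 2 < z) (z3 : y * (z + k) = (2 * k + 1) / 3) (w3 : z * (w + k) = (2 * k + 1) / 3) :
    (k + 1 - y) * (z + k) * (w + k) ≤ (2 * k + 1) ^ 3 / (3 * (k + 2)) := by
  have yz : y * z = (2 * k + 1) / 3 - k * y := by linarith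
  have b1 : (k + 1 - y) * (z + k) * (w + k) * (y * z)
      = (k + 1 - y) * ((2 * k + 1) / 3) ^ 2 := by
    linear_combination (k + 1 - y) * (w + k) * z * z3
      + (k + 1 - y) * ((2 * k + 1) / 3) * w3
  have b2 : 0 < y * z := by positivity
  have b3 : 0 ≤ (y - 1 / 2) * ((2 * k + 1) / 3 - k ^ 2 - k) :=
    mul_nonneg (by linarith) (by nlinarith)
  have b4 : (k + 1 - y) * ((2 * k + 1) / 3) ^ 2
      ≤ (2 * k + 1) ^ 3 / (3 * (k + 2)) * (y * z) := by
    rw [yz, div_mul_eq_mul_div, le_div_iff₀ (by linarith)]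
    have := mul_nonneg b3 (sq_nonneg (2 * k + 1))
    linear_combination 2 * this
  rw [← b1] at b4
  exact le_of_mul_le_mul_right b4 b2

theorem high_low_low_le (H : FoldedSystem k m d) {e : ℝ} (e0 : 0 ≤ e)
    (he : ∀ u, 1 / 2 ≤ u → u < 2 / 3 → -e ≤ d u) {y z : ℝ} (hy : 1 / 2 ≤ y) (hy' : y < 2 / 3)
    (h1 : y * (k + 2) ≤ k ^ 2 + k + 1) (z3 : y * (z + k) = (2 * k + 1) / 3)
    (hz : 1 / 2 < z) (hz' : z < 2 / 3) (my : m y = 1 + y * m z) :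
    m y + (k + 1 - y) * (m z - (z + k) * d z) ≤ dUp k + 9 / 10 * e := by
  have k0 := H.k_nonneg
  have k1 := H.k_le
  obtain ⟨w, w1, w2, w3, mz, dz, mw, dw⟩ := H.low_chain hy h1 z3 hz hz' e0 he
  have hE0 : 0 ≤ (k + 1 - y) * (z + k) * (w + k) :=
    mul_nonneg (mul_nonneg (by linarith) (by linarith)) (by linarith)
  have hE1 : (k + 1 - y) * (z + k) * (w + k) ≤ 66 / 100 * 1 * 1 :=
    mul_le_mul (mul_le_mul (by linarith) (by linarith) (by linarith) (by norm_num))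
      (by linarith) (by linarith) (by norm_num)
  have hC : 0 ≤ 1 / 3 - k / 3 - k ^ 2 := by nlinarith
  have kL : 0 ≤ 1 - k * mLow k := by
    have := mul_le_mul_of_nonneg_left (mLow_le k0 k1) k0
    nlinarith
  have t1 := mul_le_mul_of_nonneg_left dw hE0
  have t2 := mul_le_mul_of_nonneg_right hE1 e0
  have t3 := mul_le_mul_of_nonneg_right (chain_weight_le k0 k1 hy hz z3 w3) kL
  have t4 := mul_le_mul_of_nonneg_left mw hC
  have t5 := dUp_bound_low k0 k1
  -- The relation `y * (z + k) = γ` makes the coefficient of `m w` independent of `y` and `z`.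
  have id : m y + (k + 1 - y) * (m z - (z + k) * d z) = k + 2 + (1 / 3 - k / 3 - k ^ 2) * m w
      + (k + 1 - y) * (z + k) * (w + k) * d w := by
    rw [my, mz, dz]
    linear_combination m w * z3
  rw [id]
  generalize (k + 1 - y) * (z + k) * (w + k) = E at *
  generalize (1 / 3 - k / 3 - k ^ 2) = c at *
  generalize (2 * k + 1) ^ 3 / (3 * (k + 2)) = f at *
  linarith

/-- Unrolling `d` along the orbit until its remaining coefficient has the favourable sign. The upper
bound on the low branch and the lower bound on the high one need a single step. The lower bound on
the low branch is where `dUp` is critical; the upper bound on the high branch needs up to five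
steps. -/
theorem diff_step (H : FoldedSystem k m d) {e : ℝ} (e0 : 0 ≤ e)
    (he : ∀ x, 1 / 2 ≤ x → x ≤ (k + 2) / 3 → -e ≤ d x ∧ d x ≤ dUp k + e) {x : ℝ}
    (h1 : 1 / 2 ≤ x) (h2 : x ≤ (k + 2) / 3) :
    -(9 / 10 * e) ≤ d x ∧ d x ≤ dUp k + 9 / 10 * e := by
  have k0 := H.k_nonneg
  have k1 := H.k_le
  have L1 := mLow_ge k0 k1
  have L2 := mLow_le k0 k1
  have M1 := mUp_ge k0 k1
  have M2 := mUp_le k0 k1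
  have MD := mUp_le_dUp k0 k1
  rcases lt_or_ge x (2 / 3) with hx | hx
  · rcases h1.eq_or_lt with rfl | h1
    · rw [H.d_half]
      constructor <;> linarith
    obtain ⟨z, z1, z2, z3, z4, z5⟩ := H.low x h1.le hx
    have zk : 0 ≤ z + k := by linarith
    have zk' : z + k ≤ 9 / 10 := by linarith
    have ze := mul_le_mul_of_nonneg_right zk' e0
    rw [z5 h1]
    refine ⟨?_, ?_⟩
    · rcases lt_or_ge z (2 / 3) with hz | hz
      · obtain ⟨w, w1, w2, w3, w4, w5⟩ := H.low z z1.le hz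
        have hw := mul_le_mul_of_nonneg_left (he w w1.le w2).1 (mul_nonneg zk (show 0 ≤ w + k by linarith))
        have hm := mul_le_mul_of_nonneg_left (H.apply_le_mUp w1.le w2) k0
        have c := mul_le_mul zk' (show w + k ≤ 1 by linarith) (by linarith) (by norm_num)
        have ce := mul_le_mul_of_nonneg_right c e0
        -- Here `d x = 1 - k * m w + (z + k) * (w + k) * d w`, and `k * mUp k ≤ 1`.
        rw [w5 z1, w4]
        nlinarith
      · obtain ⟨w, w1, w2, -, -, w4, -⟩ := H.high z hz z2
        have hd := mul_le_mul_of_nonneg_left (he z z1.le z2).2 zk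
        have hm := mul_le_mul_of_nonneg_left (H.mLow_le_apply w1 (by linarith))
          (show 0 ≤ z by linarith)
        have hD := dUp_eq k0 k1
        -- The claim `(z + k) * dUp ≤ 1 + z * mLow` is an equality at `z = p`, because `p + k = 2 γ`
        -- and by `dUp_eq`; below `p` it follows from `mLow ≤ dUp`.
        have := mul_nonneg (show 0 ≤ (k + 2) / 3 - z by linarith) (show 0 ≤ dUp k - mLow k by linarith)
        rw [w4]
        linarith
    · have hd := mul_le_mul_of_nonneg_left (he z z1.le z2).1 zk
      have hm := H.apply_le_mUp z1.le z2
      linarith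
  · obtain ⟨y, y1, y2, y3, y4, y5, y6⟩ := H.high x hx h2
    have yk : 0 ≤ k + 1 - y := by linarith
    have yk' : k + 1 - y ≤ 66 / 100 := by linarith
    rw [y6]
    refine ⟨?_, ?_⟩
    · have hd := mul_le_mul_of_nonneg_left (he y y1 (by linarith)).1 yk
      have hm := H.mLow_le_apply y1 (by linarith)
      have ce := mul_le_mul_of_nonneg_right yk' e0
      linarith
    rcases y1.eq_or_lt with rfl | y1
    · rw [H.d_half]
      linarith [H.apply_le_mUp le_rfl (by linarith : (1 / 2 : ℝ) ≤ (k + 2) / 3)]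
    obtain ⟨z, z1, z2, z3, z4, z5⟩ := H.low y y1.le y2
    have zk : 0 ≤ z + k := by linarith
    have zk' : z + k ≤ 9 / 10 := by linarith
    have c0 : 0 ≤ (k + 1 - y) * (z + k) := mul_nonneg yk zk
    have c1 : (k + 1 - y) * (z + k) ≤ 66 / 100 * (9 / 10) := mul_le_mul yk' zk' zk (by norm_num)
    rw [z5 y1]
    rcases lt_or_ge z (2 / 3) with hz | hz
    · exact H.high_low_low_le e0 (fun u u1 u2 => (he u u1 (by linarith)).1) y1.le y2 y3 z3 z1 hz z4
    · obtain ⟨w, w1, w2, -, -, w4, w5⟩ := H.high z hz z2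
      have dz : m w - 66 / 100 * e ≤ d z := by
        have a1 := mul_le_mul_of_nonneg_left (he w w1 (by linarith)).1 (show 0 ≤ k + 1 - w by linarith)
        have a2 := mul_le_mul_of_nonneg_right (show k + 1 - w ≤ 66 / 100 by linarith) e0
        linarith
      have t1 := mul_le_mul_of_nonneg_left dz c0
      have t2 := mul_le_mul_of_nonneg_right c1 e0
      have hC : 0 ≤ 1 / 3 - k / 3 - k ^ 2 := by nlinarith
      have t3 := mul_le_mul_of_nonneg_left (H.apply_le_of_lt w1 w2) hC
      have t4 := dUp_bound_high k0 k1
      have id : m y + (k + 1 - y) * m z - (k + 1 - y) * (z + k) * m w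
          = k + 2 + (1 / 3 - k / 3 - k ^ 2) * m w := by
        rw [z4, w4]
        linear_combination m w * z3
      linarith

theorem diff_mem (H : FoldedSystem k m d) {x : ℝ} (h1 : 1 / 2 ≤ x) (h2 : x ≤ (k + 2) / 3) :
    0 ≤ d x ∧ d x ≤ dUp k := by
  have D0 : 0 ≤ dUp k := by linarith [mUp_le_dUp H.k_nonneg H.k_le, mUp_ge H.k_nonneg H.k_le]
  obtain ⟨C, hC⟩ := H.bound
  have hC0 : 0 ≤ C := (abs_nonneg _).trans (hC x h1 h2).1
  have key : ∀ ε > 0, ∃ e, 0 ≤ e ∧ e < ε ∧ ∀ x, 1 / 2 ≤ x → x ≤ (k + 2) / 3 →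
      -e ≤ d x ∧ d x ≤ dUp k + e := fun ε hε =>
    exists_small_of_contracts hC0
      (fun x h1 h2 => ⟨neg_le_of_abs_le (hC x h1 h2).2,
        by linarith [le_of_abs_le (hC x h1 h2).2]⟩)
      (fun e e0 he x h1 h2 => H.diff_step e0 he h1 h2) hε
  constructor <;> refine le_of_forall_pos_lt_add fun ε hε => ?_ <;>
    obtain ⟨e, -, e1, he⟩ := key ε hε <;> have := he x h1 h2
  · linarith
  · linarith

theorem one_add_le_apply (H : FoldedSystem k m d) : 1 + (k + 2) / 3 * mLow k ≤ m ((k + 2) / 3) := by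
  have k0 := H.k_nonneg
  obtain ⟨y, y1, y2, -, -, y3, -⟩ := H.high ((k + 2) / 3) (by linarith) le_rfl
  have := H.mLow_le_apply y1 (by linarith)
  rw [y3]
  gcongr

/-- For the action that `σ*` never plays in the given state; with `y = p` it is also what the state
`1/2` needs. -/
theorem add_diff_le (H : FoldedSystem k m d) {y : ℝ} (h1 : 1 / 2 ≤ y) (h2 : y ≤ (k + 2) / 3) :
    (2 * k + 1) / 3 * (d ((k + 2) / 3) + d y) ≤ m ((k + 2) / 3) := by
  have k0 := H.k_nonneg
  have a1 := (H.diff_mem h1 h2).2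
  have a2 := (H.diff_mem (h1.trans h2) le_rfl).2
  have a3 := mul_le_mul_of_nonneg_left (add_le_add a2 a1) (show 0 ≤ (2 * k + 1) / 3 by linarith)
  linarith [H.one_add_le_apply, dUp_eq k0 H.k_le]

/-- Makes `xStar` a probability on `(1/2, 2/3)`, where the successor is folded and its difference
changes sign. -/
theorem sub_diff_mem (H : FoldedSystem k m d) {y : ℝ} (h1 : 1 / 2 ≤ y) (h2 : y ≤ (k + 2) / 3) :
    0 ≤ m y - (y + (k + 2) / 3 - 1) * d y ∧
      m y - (y + (k + 2) / 3 - 1) * d y ≤ m ((k + 2) / 3) := by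
  have k0 := H.k_nonneg
  have k1 := H.k_le
  obtain ⟨d0, d1⟩ := H.diff_mem h1 h2
  have hp := H.one_add_le_apply
  refine ⟨?_, ?_⟩
  · have a1 := H.mLow_le_apply h1 h2
    have a2 := dUp_eq k0 k1
    have a3 := mul_le_mul (show y + (k + 2) / 3 - 1 ≤ (2 * k + 1) / 3 by linarith) d1 d0 (by linarith)
    have a4 := mLow_mul k1
    linarith
  · rcases lt_or_ge y (2 / 3) with h | h
    · have a1 := H.apply_le_of_lt h1 h
      have a2 := mul_nonneg (show 0 ≤ y + (k + 2) / 3 - 1 by linarith) d0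
      linarith [mUp_low_le k0 k1]
    · obtain ⟨w, w1, w2, -, -, w3, w4⟩ := H.high y h h2
      have a1 := mul_nonneg (show 0 ≤ k + 1 - w by linarith) (H.diff_mem w1 (by linarith)).1
      have a2 : m w ≤ d y := by linarith
      have a3 := mul_le_mul_of_nonneg_left a2 (show 0 ≤ y + (k + 2) / 3 - 1 by linarith)
      have a4 := H.apply_le_mUp w1 (by linarith)
      have a5 := mul_le_mul_of_nonneg_left a4 (show 0 ≤ 1 - (k + 2) / 3 by linarith)
      have a6 := mul_le_mul_of_nonneg_left (mLow_ge k0 k1) (show 0 ≤ (k + 2) / 3 by linarith)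
      have a7 := mUp_le k0 k1
      nlinarith

/-- Makes `xStar` a probability on `[2/3, p]`, where the successor `y` lies below the image of `p`.
The upper bound unrolls `d y` as in `diff_step`. -/
theorem add_diff_mem (H : FoldedSystem k m d) {y : ℝ} (y1 : 1 / 2 ≤ y) (y2 : y < 2 / 3)
    (y3 : y * (k + 2) ≤ k ^ 2 + k + 1) :
    0 ≤ m y + ((k + 2) / 3 - y) * d y ∧ m y + ((k + 2) / 3 - y) * d y ≤ m ((k + 2) / 3) := by
  have k0 := H.k_nonneg
  have k1 := H.k_le
  have hp := H.one_add_le_apply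
  have yp : 0 ≤ (k + 2) / 3 - y := by linarith
  refine ⟨?_, ?_⟩
  · have a1 := H.mLow_le_apply y1 (by linarith)
    have a2 := mul_nonneg yp (H.diff_mem y1 (by linarith)).1
    linarith [mLow_ge k0 k1]
  rcases y1.eq_or_lt with rfl | y1
  · rw [H.d_half]
    linarith [H.apply_le_of_lt le_rfl y2, mUp_low_le k0 k1]
  obtain ⟨z, z1, z2, z3, z4, z5⟩ := H.low y y1.le y2
  have zk : 0 ≤ z + k := by linarith
  have hg : 0 ≤ (2 * k + 1) / 3 - (k + 2) / 3 * k := by nlinarith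
  refine le_trans ?_ hp
  rw [z5 y1, z4]
  rcases lt_or_ge z (2 / 3) with hz | hz
  · obtain ⟨w, w1, w2, w3, mz, dz, mw, dw⟩ := H.low_chain y1.le y3 z3 z1 hz le_rfl
      fun u u1 u2 => by linarith [(H.diff_mem u1 (by linarith)).1]
    have kL : 0 ≤ 1 - k * mLow k := by
      have := mul_le_mul_of_nonneg_left (mLow_le k0 k1) k0
      nlinarith
    -- Since `z + k = γ / y`, the product is largest at `y = 1/2`, where it equals `γ ^ 2`.
    have c1 : ((k + 2) / 3 - y) * (z + k) ≤ ((2 * k + 1) / 3) ^ 2 := by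
      nlinarith
    have c2 : w + k ≤ 1 / 2 + k * (5 / 4) := by linarith
    have c3 := mul_le_mul c1 c2 (by linarith) (by positivity)
    have c4 := mul_le_mul_of_nonneg_right c3 kL
    have c5 := mul_le_mul_of_nonneg_left dw
      (mul_nonneg (mul_nonneg yp zk) (show 0 ≤ w + k by linarith))
    have c6 := mul_le_mul_of_nonneg_left mw hg
    have c7 := lowProb_bound_low k0 k1
    have id : 1 + y * m z + ((k + 2) / 3 - y) * (m z - (z + k) * d z)
        = 1 + ((k + 2) / 3 + ((2 * k + 1) / 3 - (k + 2) / 3 * k) * m w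
          + ((k + 2) / 3 - y) * (z + k) * (w + k) * d w) := by
      rw [mz, dz]
      linear_combination m w * z3
    rw [id]
    linarith
  · obtain ⟨w, w1, w2, -, -, w4, w5⟩ := H.high z hz z2
    have a1 := mul_nonneg (show 0 ≤ k + 1 - w by linarith) (H.diff_mem w1 (by linarith)).1
    have a2 := mul_le_mul_of_nonneg_left (show m w ≤ d z by linarith) (mul_nonneg yp zk)
    have c6 := mul_le_mul_of_nonneg_left (H.apply_le_of_lt w1 w2) hg
    have c7 := lowProb_bound_high k0 k1
    have id : 1 + y * m z + ((k + 2) / 3 - y) * m z - ((k + 2) / 3 - y) * (z + k) * m w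
        = 1 + ((k + 2) / 3 + ((2 * k + 1) / 3 - (k + 2) / 3 * k) * m w) := by
      rw [w4]
      linear_combination m w * z3
    linarith

end FoldedSystem

/-! ### From the folded system back to the scores -/

section

variable {p : ℝ}

/-- `Phi p x = 3 p - 1 - γ / x` crosses `1/2` exactly at `x = 2/3`: on the low branch the successor
is replaced by its reflection `z = 1 - Phi p x`, on the high branch it is kept. -/
theorem foldedSystem (h1 : 2 / 3 ≤ p) (h2 : p ≤ 0.719023) :
    FoldedSystem (3 * p - 2) (wMean p) (wDiff p) := by
  have hp : p ∈ Icc (1 / 2 : ℝ) (3 / 4) := ⟨by linarith, by linarith⟩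
  refine ⟨by linarith, by linarith, fun x x1 x2 => ?_, fun x x1 x2 => ?_, wDiff_half hp,
    80, fun x x1 x2 => ?_⟩
  · have x0 : 0 < x := by linarith
    have hd : x * (gam p / x) = gam p := mul_div_cancel₀ _ x0.ne'
    have hΦ := Phi_of_le (p := p) x1
    unfold gam at *
    refine ⟨1 - Phi p x, ?_, ?_, ?_, ?_, ?_⟩
    · rw [hΦ]
      have : 3 / 2 * (2 * p - 1) < (2 * p - 1) / x := by
        rw [lt_div_iff₀ x0]
        nlinarith
      linarith
    · rw [hΦ]
      have : (2 * p - 1) / x ≤ 2 * (2 * p - 1) := by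
        rw [div_le_iff₀ x0]
        nlinarith
      linarith
    · rw [hΦ]
      linear_combination hd
    · rw [wMean_symm hp]
      rcases x1.lt_or_eq with x1 | rfl
      · exact wMean_of_gt hp x1
      · have : Phi p (1 / 2) = 1 - p := by norm_num [Phi, fB]
        rw [this, wMean_symm hp, wMean_half hp]
    · intro x1
      rw [wMean_symm hp, wDiff_symm hp, wDiff_of_gt hp x1]
      ring
  · have x0 : 0 < x := by linarith
    have x3 : x ≤ p := by linarith
    have hd : x * (gam p / x) = gam p := mul_div_cancel₀ _ x0.ne'
    have hΦ := Phi_of_le (p := p) (show 1 / 2 ≤ x by linarith)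
    unfold gam at *
    have a1 : (2 * p - 1) / x ≤ 3 / 2 * (2 * p - 1) := by
      rw [div_le_iff₀ x0]
      nlinarith
    have a2 : (2 * p - 1) / p ≤ (2 * p - 1) / x := by
      gcongr
      linarith
    have a3 : p * ((2 * p - 1) / p) = 2 * p - 1 := mul_div_cancel₀ _ (by linarith)
    have a4 := mul_le_mul_of_nonneg_left a2 (show 0 ≤ p by linarith)
    refine ⟨Phi p x, ?_, ?_, ?_, ?_, wMean_of_gt hp (by linarith), ?_⟩
    · rw [hΦ]
      linarith
    · rw [hΦ]
      nlinarith
    · rw [hΦ]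
      nlinarith
    · rw [hΦ]
      linear_combination hd
    · rw [wDiff_of_gt hp (by linarith)]
      ring
  · have a0 := abs_le.1 (wVec_abs_le hp x 0)
    have a1 := abs_le.1 (wVec_abs_le hp x 1)
    have x3 : x ≤ 1 := by linarith
    rw [abs_le, abs_le, wMean, wDiff]
    refine ⟨⟨?_, ?_⟩, ?_, ?_⟩ <;> nlinarith

/-- The bounds at the successor of an internal state that make the scores a solution. -/
theorem succ_bounds (h1 : 2 / 3 ≤ p) (h2 : p ≤ 0.719023) {θ : ℝ} (t1 : 1 / 2 < θ) (t2 : θ ≤ p) :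
    gam p * (wDiff p p - wDiff p (Phi p θ)) ≤ wMean p p ∧
    0 ≤ wMean p (Phi p θ) + (p - Phi p θ) * wDiff p (Phi p θ) ∧
    wMean p (Phi p θ) + (p - Phi p θ) * wDiff p (Phi p θ) ≤ wMean p p := by
  have hp : p ∈ Icc (1 / 2 : ℝ) (3 / 4) := ⟨by linarith, by linarith⟩
  have H := foldedSystem h1 h2
  have e1 : (3 * p - 2 + 2) / 3 = p := by ring
  have e2 : (2 * (3 * p - 2) + 1) / 3 = gam p := by unfold gam; ring
  have hg : 0 ≤ gam p := by unfold gam; linarith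
  have t0 : θ ≠ 0 := by linarith
  have hΦ : θ * Phi p θ = (3 * p - 1) * θ - gam p := by
    rw [Phi_of_le t1.le]
    field_simp
  rcases lt_or_ge θ (2 / 3) with t | t
  · obtain ⟨z, z1, z2, z3, -, -⟩ := H.low θ t1.le t
    have hz : Phi p θ = 1 - z := mul_left_cancel₀ t0 (by linear_combination hΦ + z3 + e2)
    have A := H.add_diff_le z1.le z2
    have B := H.sub_diff_mem z1.le z2
    rw [e1] at A B
    rw [e2] at A
    rw [hz, wMean_symm hp, wDiff_symm hp]
    exact ⟨by linarith, by linarith [B.1], by linarith [B.2]⟩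
  · obtain ⟨y, y1, y2, y3, y4, -, -⟩ := H.high θ t (by linarith)
    have hy : Phi p θ = y := mul_left_cancel₀ t0 (by linear_combination hΦ + y4 + e2)
    have A := H.add_diff_le (y := (3 * p - 2 + 2) / 3) (by linarith) le_rfl
    have B := H.add_diff_mem y1 y2 y3
    have D := mul_nonneg hg (H.diff_mem y1 (by linarith)).1
    have D' := mul_nonneg hg (H.diff_mem (x := p) (by linarith) (by linarith)).1
    rw [e1] at A B
    rw [e2] at A
    rw [hy]
    exact ⟨by linarith, B.1, B.2⟩

/-- `4 γ Z ≤ 1`. -/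
theorem four_gam_mul_ZStar_le (h1 : 2 / 3 ≤ p) (h2 : p ≤ 0.719023) :
    4 * (gam p * ZStar p) ≤ 1 := by
  have hp : p ∈ Icc (1 / 2 : ℝ) (3 / 4) := ⟨by linarith, by linarith⟩
  have e1 : (3 * p - 2 + 2) / 3 = p := by ring
  have e2 : (2 * (3 * p - 2) + 1) / 3 = gam p := by unfold gam; ring
  have A := (foldedSystem h1 h2).add_diff_le (y := (3 * p - 2 + 2) / 3) (by linarith) le_rfl
  rw [e1, e2] at A
  have A' := mul_le_mul_of_nonneg_left A (vStar_mem hp).1.le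
  rw [vStar_mul hp] at A'
  have : ZStar p = wDiff p p * vStar p / 2 := rfl
  rw [this]
  linarith

/-! ### Player 2 -/

/-- The relative score of a position. -/
noncomputable def relScore (p : ℝ) : Sys → ℝ → ℝ
  | .lo => scoreG p
  | .hi => scoreH p

/-- The inequalities by which the scores bound every action of Player 1 at the internal state `θ`. -/
def ScoreDominates (p θ : ℝ) : Prop :=
  xStar p θ ∈ Icc (0 : ℝ) 1 ∧ ∀ s a,
    mix (xStar p θ) (stageGain s a .L) (stageGain s a .R)
      + mix p (relScore p s (belief p θ [a])) (relScore p s.flip (belief p θ [a]))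
      ≤ relScore p s θ + vStar p

theorem relScore_symm (hp : p ∈ Icc (1 / 2 : ℝ) (3 / 4)) (s : Sys) (θ : ℝ) :
    relScore p s (1 - θ) = relScore p s.flip θ := by
  cases s
  · exact score_symm hp θ
  · have := score_symm hp (1 - θ)
    rw [sub_sub_cancel] at this
    exact this.symm

theorem xStar_symm (hp : p ∈ Icc (1 / 2 : ℝ) (3 / 4)) (θ : ℝ) : xStar p (1 - θ) = 1 - xStar p θ := by
  have h := relScore_symm hp .lo θ
  have h' := relScore_symm hp .hi θ
  simp only [relScore, Sys.flip] at h h'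
  rcases lt_trichotomy θ (1 / 2) with t | t | t
  · rw [xStar, xStar, if_pos (by linarith), if_neg (by linarith), if_pos t, h]
    ring
  · subst t
    norm_num [xStar]
  · rw [xStar, xStar, if_neg (by linarith), if_pos (by linarith), if_pos t, h']

/-- The three positions with an action that `σ*` may play are equalities; only `T` in state `hi`
uses the first part of `succ_bounds`. -/
theorem scoreDominates_of_gt (h1 : 2 / 3 ≤ p) (h2 : p ≤ 0.719023) {θ : ℝ} (t1 : 1 / 2 < θ)
    (t2 : θ ≤ p) : ScoreDominates p θ := by
  have hp : p ∈ Icc (1 / 2 : ℝ) (3 / 4) := ⟨by linarith, by linarith⟩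
  obtain ⟨A, B1, B2⟩ := succ_bounds h1 h2 t1 t2
  obtain ⟨w0, w1⟩ := wVec_of_gt hp t1
  have hv := vStar_mem hp
  have hv1 := vStar_mul hp
  have A' := mul_le_mul_of_nonneg_left A hv.1.le
  have B1' := mul_nonneg hv.1.le B1
  have B2' := mul_le_mul_of_nonneg_left B2 hv.1.le
  rw [hv1] at A' B2'
  have hZ : ZStar p = wDiff p p * vStar p / 2 := rfl
  have hx : xStar p θ = scoreG p θ + vStar p + gam p * ZStar p := if_pos t1
  have hG : scoreG p θ = 1 - gam p * ZStar p - vStar p * wVec p θ 0 := rfl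
  have hH : scoreH p θ = 1 - gam p * ZStar p - vStar p * wVec p θ 1 := rfl
  obtain ⟨b0, b1⟩ := score_base hp
  obtain ⟨g0, g1⟩ := score_gt hp t1
  have hT : belief p θ [.T] = p := if_pos t1.le
  have hB : belief p θ [.B] = Phi p θ := by rw [Phi, if_pos t1.le]; rfl
  refine ⟨?_, ?_⟩
  · rw [hx, hG, w0]
    constructor <;> linarith
  · intro s a
    cases s <;> cases a <;> simp only [relScore, Sys.flip, stageGain, mix, hT, hB, b0, b1]
    · rw [hx]
      unfold gam
      linarith
    · linarith
    · rw [hH, w1, hZ]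
      rw [gam] at *
      linarith
    · rw [hx, g1, g0]
      unfold gam
      linarith

/-- The revealing actions are equalities, and the two others amount to `4 γ Z ≤ 1`. -/
theorem scoreDominates_half (h1 : 2 / 3 ≤ p) (h2 : p ≤ 0.719023) : ScoreDominates p (1 / 2) := by
  have hp : p ∈ Icc (1 / 2 : ℝ) (3 / 4) := ⟨by linarith, by linarith⟩
  have hZ := four_gam_mul_ZStar_le h1 h2
  have hx : xStar p (1 / 2) = 1 / 2 := by norm_num [xStar]
  obtain ⟨b0, b1⟩ := score_base hp
  obtain ⟨g0, g1⟩ := score_half hp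
  have hT : belief p (1 / 2) [.T] = p := if_pos le_rfl
  have hB : belief p (1 / 2) [.B] = 1 - p := fB_of_le_half le_rfl
  have c0 := relScore_symm hp .lo p
  have c1 := relScore_symm hp .hi p
  simp only [relScore, Sys.flip] at c0 c1
  refine ⟨by rw [hx]; norm_num, fun s a => ?_⟩
  rw [hx]
  unfold gam at *
  cases s <;> cases a <;>
    simp only [relScore, Sys.flip, stageGain, mix, hT, hB, c0, c1, b0, b1, g0, g1] <;> linarith

theorem scoreDominates_symm (hp : p ∈ Icc (1 / 2 : ℝ) (3 / 4)) {θ : ℝ} (t : 1 / 2 < θ)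
    (h : ScoreDominates p θ) : ScoreDominates p (1 - θ) := by
  obtain ⟨hx, hs⟩ := h
  have hT : belief p (1 - θ) [.T] = 1 - belief p θ [.B] := by
    have := fT_eq_one_sub_fB (p := p) (show 1 - θ < 1 / 2 by linarith)
    rw [sub_sub_cancel] at this
    exact this
  have hB : belief p (1 - θ) [.B] = 1 - belief p θ [.T] := by
    have e : belief p θ [.T] = p := if_pos t.le
    rw [e]
    exact fB_of_le_half (θ := 1 - θ) (by linarith)
  refine ⟨?_, fun s a => ?_⟩
  · rw [xStar_symm hp]
    exact ⟨by linarith [hx.2], by linarith [hx.1]⟩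
  · cases a
    · have := hs s.flip .B
      rw [hT]
      simp only [relScore_symm hp, xStar_symm hp]
      cases s <;> simp only [Sys.flip, stageGain, mix] at this ⊢ <;> linarith
    · have := hs s.flip .T
      rw [hB]
      simp only [relScore_symm hp, xStar_symm hp]
      cases s <;> simp only [Sys.flip, stageGain, mix] at this ⊢ <;> linarith

theorem scoreDominates (h1 : 2 / 3 ≤ p) (h2 : p ≤ 0.719023) {θ : ℝ} (hθ : θ ∈ Icc (1 - p) p) :
    ScoreDominates p θ := by
  have hp : p ∈ Icc (1 / 2 : ℝ) (3 / 4) := ⟨by linarith, by linarith⟩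
  rcases lt_trichotomy θ (1 / 2) with t | rfl | t
  · have := scoreDominates_symm hp (θ := 1 - θ) (by linarith)
      (scoreDominates_of_gt h1 h2 (by linarith) (by linarith [hθ.1]))
    rwa [sub_sub_cancel] at this
  · exact scoreDominates_half h1 h2
  · exact scoreDominates_of_gt h1 h2 t hθ.2

theorem relScore_mem (hp : p ∈ Icc (1 / 2 : ℝ) (3 / 4)) (s : Sys) (θ : ℝ) :
    relScore p s θ ∈ Icc (-(|1 - gam p * ZStar p| + 40)) (|1 - gam p * ZStar p| + 40) := by
  have hv := vStar_mem hp
  have key : ∀ i, |1 - gam p * ZStar p - vStar p * wVec p θ i| ≤ |1 - gam p * ZStar p| + 40 := by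
    intro i
    refine (abs_sub _ _).trans (add_le_add le_rfl ?_)
    rw [abs_mul, abs_of_pos hv.1]
    have := wVec_abs_le hp θ i
    nlinarith [hv.2, hv.1, abs_nonneg (wVec p θ i)]
  cases s
  · exact abs_le.1 (key 0)
  · exact abs_le.1 (key 1)

end

end AsymGame

theorem mainTheorem3 (p : ℝ) (hp : 2 / 3 ≤ p) (hp' : p ≤ 0.719023)
    (q : ℝ) (hq : q ∈ Set.Icc (0 : ℝ) 1) (θ₀ : ℝ) (hθ₀ : θ₀ ∈ Set.Icc (1 - p) p) :
    AsymGame.IsOptimal1 p q (AsymGame.sigmaStar p θ₀) ∧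
      AsymGame.IsOptimal2 p q (AsymGame.automatonStrategy p θ₀ (AsymGame.xStar p)) := by
  open AsymGame in
  have hp2 : p ∈ Icc (1 / 2 : ℝ) (3 / 4) := ⟨by linarith, by linarith⟩
  refine optimal_of_guarantees (isStrategy1_sigmaStar hp2 hθ₀)
    (fun h => (scoreDominates hp hp' (belief_mem hp2 hθ₀ _)).1)
    (guarantees1_sigmaStar hp2 hq hθ₀)
    -- One copy of the bound serves the terminal score, the other the initial one.
    (guarantees2_of_bound (C := 2 * (|1 - gam p * ZStar p| + 40)) hq fun σ hσ n s => ?_)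
  have h1 := expGain_le_of_potential hp2 hθ₀ (fun θ hθ => (scoreDominates hp hp' hθ).1)
    (fun θ hθ s => (scoreDominates hp hp' hθ).2 s .T)
    (fun θ hθ s => (scoreDominates hp hp' hθ).2 s .B)
    (fun θ _ s => (relScore_mem hp2 s θ).1) hσ n [] s
  have h2 := (relScore_mem hp2 s (belief p θ₀ [])).2
  simp only [List.map_nil] at h1
  linarith
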